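/- Let $d\ge 2$, let $A,B$ be systems of dimension $d$, and let $\rho_{\hat A\hat B}$ be a state of two systems $\hat A,\hat B$ of arbitrary finite dimensions. Let $\mathcal S^d_{AB}(\omega)=F\omega F^\dagger$ with $F=\sum_{i,j=0}^{d-1}|i\rangle\langle j|_A\otimes|j\rangle\langle i|_B$ be the swap channel. An LOCC channel $\mathcal L_{A\hat A B\hat B\to AB}$ is a bipartite channel (Alice holds $A\hat A$ and outputs $A$, Bob holds $B\hat B$ and outputs $B$) that is realized by finitely many rounds of local instruments with finitely many outcomes and classical communication of the outcomes. For such $\mathcal L$ let $\widetilde{\mathcal S}_{\mathcal L}(\omega_{AB})=\mathcal L(\omega_{AB}\otimes\rho_{\hat A\hat B})$, and define $$e_{\mathrm{LOCC}}=\inf_{\mathcal L\in\mathrm{LOCC}}\tfrac12\big\|\mathcal S^d-\widetilde{\mathcal S}_{\mathcal L}\big\|_\diamond,\qquad e^F_{\mathrm{LOCC}}=\inf_{\mathcal L\in\mathrm{LOCC}}\big(1-F(\mathcal S^d,\widetilde{\mathcal S}_{\mathcal L})\big).$$ Here, for channels $\mathcal N,\mathcal N'$ with input system $C$, $\|\mathcal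 N-\mathcal N'\|_\diamond=\sup_{\sigma_{RC}}\|\mathcal N(\sigma_{RC})-\mathcal N'(\sigma_{RC})\|_1$ and $F(\mathcal N,\mathcal N')=\inf_{\sigma_{RC}}F(\mathcal N(\sigma_{RC}),\mathcal N'(\sigma_{RC}))$, over all states $\sigma_{RC}$ with a finite-dimensional reference system $R$ (on which the identity acts), where $F(\omega,\tau)=\|\sqrt\omega\sqrt\tau\|_1^2$ for states $\omega,\tau$. Let $\mathcal D(\sigma)=\frac1{d^2-1}\sum_{(z,x)\ne(0,0)}W^{z,x}\sigma(W^{z,x})^\dagger$, where $z,x\in\{0,\dots,d-1\}$, $W^{z,x}=Z(z)X(x)$, $Z(z)=\sum_k e^{2\pi i kz/d}|k\rangle\langle k|$ and $X(x)=\sum_k|k\oplus_d x\rangle\langle k|$. Then $$e_{\mathrm{LOCC}}=e^F_{\mathrm{LOCC}}=1-\sup_{K,L,M,N}\operatorname{Tr}[\rho_{\hat A\hat B}K_{\hat A\hat B}],$$ where the supremum is over all operators $K,L,M,N\ge0$ on $\hat A\hat B$ with $K+L+M+N=I_{\hat A\hat B}$ for which the following channel is LOCC: $$\begin{aligned}\mathcal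 L(\omega_{AB\hat A\hat B})={}&\mathcal S^d(\operatorname{Tr}_{\hat A\hat B}[K\omega])+(\mathrm{id}_{A\to B}\otimes\mathcal D_{B\to A})(\operatorname{Tr}_{\hat A\hat B}[L\omega])\\&+(\mathcal D_{A\to B}\otimes\mathrm{id}_{B\to A})(\operatorname{Tr}_{\hat A\hat B}[M\omega])+(\mathcal D_{A\to B}\otimes\mathcal D_{B\to A})(\operatorname{Tr}_{\hat A\hat B}[N\omega]).\end{aligned}$$ The set of such $(K,L,M,N)$ is nonempty, and the values $\operatorname{Tr}[\rho K]$ are bounded above. -/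

import Mathlib

open scoped Kronecker Matrix MatrixOrder ComplexOrder

noncomputable section

namespace BQT

/-- Operators on the Hilbert space `ℂ^a` with orthonormal basis labelled by the finite type `a`.
The tensor product of the systems `a` and `b` is the system `a × b`. -/
abbrev Op (a : Type) := Matrix a a ℂ

section Basics

variable {a b c e a' b' : Type}
  [Fintype a] [DecidableEq a] [Fintype b] [DecidableEq b] [Fintype c] [DecidableEq c]
  [Fintype e] [DecidableEq e] [Fintype a'] [DecidableEq a'] [Fintype b'] [DecidableEq b']

/-- A quantum state: a positive semi-definite operator of trace one. -/
def IsState (ρ : Op a) : Prop := ρ.PosSemidef ∧ ρ.trace = 1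

/-- The tensor product `E ⊗ F` of two linear maps on operators, determined by
`(E ⊗ F) (X ⊗ Y) = E X ⊗ F Y`. -/
def tensorMap (E : Op a →ₗ[ℂ] Op a') (F : Op b →ₗ[ℂ] Op b') :
    Op (a × b) →ₗ[ℂ] Op (a' × b') :=
  (kroneckerLinearEquiv a' a' b' b' ℂ).toLinearMap ∘ₗ TensorProduct.map E F ∘ₗ
    (kroneckerLinearEquiv a a b b ℂ).symm.toLinearMap

/-- Complete positivity: `id_R ⊗ E` preserves positive semi-definiteness for every
finite-dimensional reference system `R`. -/
def IsCP (E : Op a →ₗ[ℂ] Op b) : Prop :=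
  ∀ (r : ℕ) (X : Op (Fin r × a)), X.PosSemidef →
    (tensorMap (LinearMap.id : Op (Fin r) →ₗ[ℂ] Op (Fin r)) E X).PosSemidef

/-- A quantum channel: a completely positive, trace-preserving map. -/
def IsChannel (E : Op a →ₗ[ℂ] Op b) : Prop :=
  IsCP E ∧ ∀ X : Op a, (E X).trace = X.trace

/-- A quantum instrument with `n` outcomes: completely positive maps whose sum is trace
preserving. -/
def IsInstrument {n : ℕ} (E : Fin n → Op a →ₗ[ℂ] Op b) : Prop :=
  (∀ x, IsCP (E x)) ∧ ∀ X : Op a, (∑ x, (E x X).trace) = X.trace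

/-- The trace norm `‖X‖₁ = Tr |X|` with `|X| = √(X† X)`. -/
def traceNorm (X : Op a) : ℝ := (CFC.sqrt (Xᴴ * X)).trace.re

/-- The fidelity `F(ω, τ) = ‖√ω √τ‖₁²`. -/
def fidelity (ω τ : Op a) : ℝ := traceNorm (CFC.sqrt ω * CFC.sqrt τ) ^ 2

/-- The diamond distance `‖N - N'‖_⋄`: the supremum of `‖N(ρ_RC) - N'(ρ_RC)‖₁` over all states of
a reference system `R` of arbitrary finite dimension and the channel input `C`. -/
def diamondDist (N N' : Op c →ₗ[ℂ] Op e) : ℝ :=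
  sSup {x : ℝ | ∃ (r : ℕ) (ρ : Op (Fin r × c)), IsState ρ ∧
    x = traceNorm (tensorMap LinearMap.id N ρ - tensorMap LinearMap.id N' ρ)}

/-- The channel fidelity: the infimum of `F(N(ρ_RC), N'(ρ_RC))` over all states of a reference
system `R` of arbitrary finite dimension and the channel input `C`. -/
def channelFidelity (N N' : Op c →ₗ[ℂ] Op e) : ℝ :=
  sInf {x : ℝ | ∃ (r : ℕ) (ρ : Op (Fin r × c)), IsState ρ ∧
    x = fidelity (tensorMap LinearMap.id N ρ) (tensorMap LinearMap.id N' ρ)}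

/-- The map `X ↦ U X U†`. -/
def conjMap (U : Matrix b a ℂ) : Op a →ₗ[ℂ] Op b where
  toFun X := U * X * Uᴴ
  map_add' X Y := by rw [Matrix.mul_add, Matrix.add_mul]
  map_smul' r X := by simp

end Basics

/-- `IsLOCC L`: the bipartite map `L`, from Alice's system `a` and Bob's system `b` to `a'` and `b'`,
is realised by local operations and classical communication in a finite number of rounds.
A protocol is a finite tree. At a leaf Alice and Bob apply local channels. At an inner node one
party applies a local instrument with finitely many outcomes and announces the outcome `x` to the
other party, whereupon they follow the protocol `L x` on the resulting systems. -/
inductive IsLOCC {a' b' : Type} [Fintype a'] [DecidableEq a'] [Fintype b'] [DecidableEq b'] :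
    ∀ {a b : Type} [Fintype a] [DecidableEq a] [Fintype b] [DecidableEq b],
      (Op (a × b) →ₗ[ℂ] Op (a' × b')) → Prop
  | local_channels {a b : Type} [Fintype a] [DecidableEq a] [Fintype b] [DecidableEq b]
      (E : Op a →ₗ[ℂ] Op a') (F : Op b →ₗ[ℂ] Op b') (hE : IsChannel E) (hF : IsChannel F) :
      IsLOCC (tensorMap E F)
  | alice_measures {a b m : Type} [Fintype a] [DecidableEq a] [Fintype b] [DecidableEq b]
      [Fintype m] [DecidableEq m] {n : ℕ}
      (E : Fin n → Op a →ₗ[ℂ] Op m) (hE : IsInstrument E)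
      (L : Fin n → Op (m × b) →ₗ[ℂ] Op (a' × b')) (hL : ∀ x, IsLOCC (L x)) :
      IsLOCC (∑ x, L x ∘ₗ tensorMap (E x) (LinearMap.id : Op b →ₗ[ℂ] Op b))
  | bob_measures {a b m : Type} [Fintype a] [DecidableEq a] [Fintype b] [DecidableEq b]
      [Fintype m] [DecidableEq m] {n : ℕ}
      (F : Fin n → Op b →ₗ[ℂ] Op m) (hF : IsInstrument F)
      (L : Fin n → Op (a × m) →ₗ[ℂ] Op (a' × b')) (hL : ∀ x, IsLOCC (L x)) :
      IsLOCC (∑ x, L x ∘ₗ tensorMap (LinearMap.id : Op a →ₗ[ℂ] Op a) (F x))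

section Swap

variable (d : ℕ)

/-- The flip operator `F = ∑ i j, |i⟩⟨j| ⊗ |j⟩⟨i|`. -/
def flipOp : Op (Fin d × Fin d) :=
  ∑ i : Fin d, ∑ j : Fin d, Matrix.single i j (1 : ℂ) ⊗ₖ Matrix.single j i (1 : ℂ)

/-- The unitary swap channel `S^d(ω) = F ω F†`. -/
def swapChannel : Op (Fin d × Fin d) →ₗ[ℂ] Op (Fin d × Fin d) := conjMap (flipOp d)

/-- `Z(z) = ∑ k, exp(2πikz/d) |k⟩⟨k|`. -/
def pauliZ (z : Fin d) : Op (Fin d) :=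
  Matrix.diagonal fun k =>
    Complex.exp (2 * Real.pi * Complex.I * ((k : ℕ) : ℂ) * ((z : ℕ) : ℂ) / (d : ℂ))

/-- `X(x) = ∑ k, |k + x mod d⟩⟨k|`. -/
def pauliX (x : Fin d) : Op (Fin d) :=
  Matrix.of fun i k => if (i : ℕ) = ((k : ℕ) + (x : ℕ)) % d then 1 else 0

/-- The generalized Pauli channel
`D(σ) = (d² - 1)⁻¹ ∑_{(z,x) ≠ (0,0)} W^{z,x} σ (W^{z,x})†` with `W^{z,x} = Z(z) X(x)`. -/
def garble : Op (Fin d) →ₗ[ℂ] Op (Fin d) :=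
  ((d : ℂ) ^ 2 - 1)⁻¹ •
    ∑ p ∈ (Finset.univ : Finset (Fin d × Fin d)).filter
      (fun p => ¬ ((p.1 : ℕ) = 0 ∧ (p.2 : ℕ) = 0)),
      conjMap (pauliZ d p.1 * pauliX d p.2)

variable {d}

/-- `E_{A→B} ⊗ F_{B→A}`: the map `E` is applied to Alice's input and its output is handed to Bob,
the map `F` is applied to Bob's input and its output is handed to Alice. -/
def crossMap (E F : Op (Fin d) →ₗ[ℂ] Op (Fin d)) :
    Op (Fin d × Fin d) →ₗ[ℂ] Op (Fin d × Fin d) :=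
  swapChannel d ∘ₗ tensorMap E F

variable {a b : Type} [Fintype a] [DecidableEq a] [Fintype b] [DecidableEq b]

/-- Regroup an operator on `(A B)(Â B̂)` as an operator on `(A Â)(B B̂)`, in which Alice holds the
first pair and Bob the second. -/
def toParties (X : Op ((Fin d × Fin d) × (a × b))) : Op ((Fin d × a) × (Fin d × b)) :=
  X.submatrix (Equiv.prodProdProdComm (Fin d) a (Fin d) b)
    (Equiv.prodProdProdComm (Fin d) a (Fin d) b)

/-- Regroup an operator on `(A Â)(B B̂)` as an operator on `(A B)(Â B̂)`. -/
def ofParties (X : Op ((Fin d × a) × (Fin d × b))) : Op ((Fin d × Fin d) × (a × b)) :=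
  X.submatrix (Equiv.prodProdProdComm (Fin d) (Fin d) a b)
    (Equiv.prodProdProdComm (Fin d) (Fin d) a b)

/-- `ω ↦ ω_{AB} ⊗ ρ_{ÂB̂}`. -/
def appendState (ρ : Op (a × b)) :
    Op (Fin d × Fin d) →ₗ[ℂ] Op ((Fin d × a) × (Fin d × b)) where
  toFun ω := toParties (ω ⊗ₖ ρ)
  map_add' X Y := by rw [Matrix.add_kronecker]; rfl
  map_smul' r X := by rw [Matrix.smul_kronecker]; rfl

/-- `ω ↦ Tr_{ÂB̂}[K_{ÂB̂} ω_{ABÂB̂}]`. -/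
def measureOut (K : Op (a × b)) :
    Op ((Fin d × a) × (Fin d × b)) →ₗ[ℂ] Op (Fin d × Fin d) where
  toFun ω := Matrix.of fun i j =>
    ∑ s : a × b, (((1 : Op (Fin d × Fin d)) ⊗ₖ K) * ofParties ω) (i, s) (j, s)
  map_add' X Y := by
    ext i j
    change ∑ s, (_ * (ofParties X + ofParties Y)) (i, s) (j, s) = _
    simp only [Matrix.mul_add, Matrix.add_apply, Finset.sum_add_distrib, Matrix.of_apply]
  map_smul' r X := by
    ext i j
    change ∑ s, (_ * (r • ofParties X)) (i, s) (j, s) = _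
    simp only [Matrix.mul_smul, Matrix.smul_apply, Finset.smul_sum, Matrix.of_apply,
      RingHom.id_apply]

/-- The simulation `ω ↦ L(ω_{AB} ⊗ ρ_{ÂB̂})` of the swap channel. -/
def simulation (ρ : Op (a × b))
    (L : Op ((Fin d × a) × (Fin d × b)) →ₗ[ℂ] Op (Fin d × Fin d)) :
    Op (Fin d × Fin d) →ₗ[ℂ] Op (Fin d × Fin d) :=
  L ∘ₗ appendState ρ

variable (d) in
/-- The simulation error in normalized diamond distance, minimized over LOCC channels. -/
def errLOCC (ρ : Op (a × b)) : ℝ :=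
  sInf {x : ℝ | ∃ L : Op ((Fin d × a) × (Fin d × b)) →ₗ[ℂ] Op (Fin d × Fin d),
    IsLOCC L ∧ x = 1 / 2 * diamondDist (swapChannel d) (simulation ρ L)}

variable (d) in
/-- The simulation error in channel infidelity, minimized over LOCC channels. -/
def errFidLOCC (ρ : Op (a × b)) : ℝ :=
  sInf {x : ℝ | ∃ L : Op ((Fin d × a) × (Fin d × b)) →ₗ[ℂ] Op (Fin d × Fin d),
    IsLOCC L ∧ x = 1 - channelFidelity (swapChannel d) (simulation ρ L)}

variable (d) in
/-- The channel that measures the resource systems with the operators `K, L, M, N` and, according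
to the outcome, swaps the inputs, swaps them with Bob's input garbled, swaps them with Alice's
input garbled, or swaps them with both garbled. -/
def fourOutcomeChannel (K L M N : Op (a × b)) :
    Op ((Fin d × a) × (Fin d × b)) →ₗ[ℂ] Op (Fin d × Fin d) :=
  swapChannel d ∘ₗ measureOut K
    + crossMap LinearMap.id (garble d) ∘ₗ measureOut L
    + crossMap (garble d) LinearMap.id ∘ₗ measureOut M
    + crossMap (garble d) (garble d) ∘ₗ measureOut N

variable (d) in
/-- The numbers `Tr[ρ K]` (which are real) for four-outcome POVMs `{K, L, M, N}` on the resource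
systems whose associated channel is LOCC. -/
def successValues (ρ : Op (a × b)) : Set ℝ :=
  {x : ℝ | ∃ K L M N : Op (a × b),
    K.PosSemidef ∧ L.PosSemidef ∧ M.PosSemidef ∧ N.PosSemidef ∧ K + L + M + N = 1 ∧
    IsLOCC (fourOutcomeChannel d K L M N) ∧ x = (ρ * K).trace.re}

end Swap

end BQT

end

set_option linter.unusedSectionVars false

noncomputable section

namespace BQT

/-! ### Tensor products of superoperators and extensionality on product operators -/

section TensorMap

variable {a b c e a' b' a'' b'' : Type}
  [Fintype a] [DecidableEq a] [Fintype b] [DecidableEq b] [Fintype c] [DecidableEq c]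
  [Fintype e] [DecidableEq e] [Fintype a'] [DecidableEq a'] [Fintype b'] [DecidableEq b']
  [Fintype a''] [DecidableEq a''] [Fintype b''] [DecidableEq b'']

/-! Both errors are squeezed between matching bounds, obtained by symmetrizing an arbitrary LOCC
simulation.

Symmetrization. The swap carries `U ⊗ V` to `V ⊗ U`. So Alice and Bob may apply random `U_x†` and
`U_y†` to their inputs, announce the labels, run the given protocol, and undo the unitaries
crosswise, Alice with `U_y` and Bob with `U_x`. This is still LOCC, and the swap composed with the
new simulation is the independent twirl, on both systems, of the swap composed with the old one
(`IsLOCC.exists_doubleTwirl`). For a unitary 2-design, twirling leaves only the identity and the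
garbling channel, with weights that are entanglement fidelities (`exists_twirl_eq_garble`,
`doubleTwirl_eq`). The four resulting weights are linear in the resource operator and nonnegative on
positive ones, hence are trace pairings with positive operators, which sum to the identity by trace
preservation. Since this holds for every appended operator, the symmetrized protocol itself is the
four-outcome channel. The error-free weight at `ρ` is the entanglement fidelity of the original
simulation (`IsLOCC.entFid_mem_successValues`).

Bounds. A maximally entangled input shows that each error of a simulation is at least its
entanglement infidelity (`le_half_diamondDist`, `channelFidelity_le_entFid`). Conversely, a
four-outcome channel simulates `Tr[ρK]` times the swap plus a completely positive rest
(`exists_simulation_eq`), so both errors are at most `1 - Tr[ρK]` (`half_diamondDist_le`,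
`le_channelFidelity`).

The 2-design is built explicitly: diagonal phases and permutations reduce a superoperator to
identity, trace-out and dephasing, and a Fourier transform of suitable probability absorbs the
dephasing (`exists_twirl_eq`). -/

theorem conjMap_apply (U : Matrix b a ℂ) (X : Op a) : conjMap U X = U * X * Uᴴ := rfl

@[simp]
theorem tensorMap_kronecker (E : Op a →ₗ[ℂ] Op a') (F : Op b →ₗ[ℂ] Op b') (X : Op a) (Y : Op b) :
    tensorMap E F (X ⊗ₖ Y) = E X ⊗ₖ F Y := by
  simp [tensorMap]

theorem single_eq_kronecker (i k : a) (j l : b) :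
    (Matrix.single (i, j) (k, l) (1 : ℂ) : Op (a × b))
      = Matrix.single i k 1 ⊗ₖ Matrix.single j l 1 := by
  rw [Matrix.single_kronecker_single]; simp

theorem op_ext {V : Type*} [AddCommMonoid V] [Module ℂ V] {G H : Op a →ₗ[ℂ] V}
    (h : ∀ i j, G (Matrix.single i j 1) = H (Matrix.single i j 1)) : G = H := by
  refine Matrix.ext_linearMap ℂ fun i j => LinearMap.ext_ring ?_
  simpa using h i j

theorem op_prod_ext {V : Type*} [AddCommMonoid V] [Module ℂ V] {G H : Op (a × b) →ₗ[ℂ] V}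
    (h : ∀ X Y, G (X ⊗ₖ Y) = H (X ⊗ₖ Y)) : G = H := by
  refine op_ext ?_
  rintro ⟨i, j⟩ ⟨k, l⟩
  rw [single_eq_kronecker, h]

theorem tensorMap_comp (E : Op a →ₗ[ℂ] Op a') (F : Op b →ₗ[ℂ] Op b') (E' : Op a' →ₗ[ℂ] Op a'')
    (F' : Op b' →ₗ[ℂ] Op b'') :
    tensorMap E' F' ∘ₗ tensorMap E F = tensorMap (E' ∘ₗ E) (F' ∘ₗ F) :=
  op_prod_ext fun X Y => by simp

theorem tensorMap_comp_apply (E : Op a →ₗ[ℂ] Op a') (F : Op b →ₗ[ℂ] Op b')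
    (E' : Op a' →ₗ[ℂ] Op a'') (F' : Op b' →ₗ[ℂ] Op b'') (X : Op (a × b)) :
    tensorMap E' F' (tensorMap E F X) = tensorMap (E' ∘ₗ E) (F' ∘ₗ F) X :=
  LinearMap.congr_fun (tensorMap_comp E F E' F') X

@[simp]
theorem tensorMap_id : tensorMap (LinearMap.id : Op a →ₗ[ℂ] Op a) (LinearMap.id : Op b →ₗ[ℂ] Op b)
    = LinearMap.id :=
  op_prod_ext fun X Y => by simp

theorem tensorMap_conjMap (U : Matrix a' a ℂ) (V : Matrix b' b ℂ) :
    tensorMap (conjMap U) (conjMap V) = conjMap (U ⊗ₖ V) :=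
  op_prod_ext fun X Y => by
    simp [conjMap_apply, Matrix.mul_kronecker_mul, Matrix.conjTranspose_kronecker]

theorem conjMap_one : conjMap (1 : Op a) = LinearMap.id := by
  ext1 X; simp [conjMap_apply]

theorem conjMap_comp (U : Matrix b a ℂ) (V : Matrix c b ℂ) :
    conjMap V ∘ₗ conjMap U = conjMap (V * U) := by
  ext1 X; simp [conjMap_apply, Matrix.mul_assoc]

/-- `tensorMap` as a bilinear map. -/
def tensorMapBilin : (Op a →ₗ[ℂ] Op a') →ₗ[ℂ] (Op b →ₗ[ℂ] Op b') →ₗ[ℂ]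
    (Op (a × b) →ₗ[ℂ] Op (a' × b')) :=
  LinearMap.mk₂ ℂ tensorMap
    (fun _ _ _ => op_prod_ext fun X Y => by simp [Matrix.add_kronecker])
    (fun _ _ _ => op_prod_ext fun X Y => by simp [Matrix.smul_kronecker])
    (fun _ _ _ => op_prod_ext fun X Y => by simp [Matrix.kronecker_add])
    (fun _ _ _ => op_prod_ext fun X Y => by simp [Matrix.kronecker_smul])

theorem tensorMapBilin_apply (E : Op a →ₗ[ℂ] Op a') (F : Op b →ₗ[ℂ] Op b') :
    tensorMapBilin E F = tensorMap E F := rfl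

theorem tensorMap_sum_left {ι : Type*} (s : Finset ι) (E : ι → Op a →ₗ[ℂ] Op a')
    (F : Op b →ₗ[ℂ] Op b') : tensorMap (∑ i ∈ s, E i) F = ∑ i ∈ s, tensorMap (E i) F := by
  simp only [← tensorMapBilin_apply, map_sum, LinearMap.sum_apply]

theorem tensorMap_sum_right {ι : Type*} (s : Finset ι) (E : Op a →ₗ[ℂ] Op a')
    (F : ι → Op b →ₗ[ℂ] Op b') : tensorMap E (∑ i ∈ s, F i) = ∑ i ∈ s, tensorMap E (F i) := by
  simp only [← tensorMapBilin_apply, map_sum]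

theorem tensorMap_smul_left (r : ℂ) (E : Op a →ₗ[ℂ] Op a') (F : Op b →ₗ[ℂ] Op b') :
    tensorMap (r • E) F = r • tensorMap E F := by
  simp only [← tensorMapBilin_apply, map_smul, LinearMap.smul_apply]

theorem tensorMap_smul_right (r : ℂ) (E : Op a →ₗ[ℂ] Op a') (F : Op b →ₗ[ℂ] Op b') :
    tensorMap E (r • F) = r • tensorMap E F := by
  simp only [← tensorMapBilin_apply, map_smul]

theorem tensorMap_add_right (E : Op a →ₗ[ℂ] Op a') (F F' : Op b →ₗ[ℂ] Op b') :
    tensorMap E (F + F') = tensorMap E F + tensorMap E F' := by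
  simp only [← tensorMapBilin_apply, map_add]

/-- The linear map `|k⟩⟨l| ↦ |i⟩⟨j|` that kills the other matrix units. -/
def unitMap (i j : b) (k l : a) : Op a →ₗ[ℂ] Op b :=
  (LinearMap.toSpanSingleton ℂ (Op b) (Matrix.single i j 1)) ∘ₗ Matrix.entryLinearMap ℂ ℂ k l

theorem unitMap_apply (i j : b) (k l : a) (X : Op a) :
    unitMap i j k l X = X k l • Matrix.single i j (1 : ℂ) := rfl

theorem op_eq_sum_single (X : Op a) : X = ∑ k, ∑ l, X k l • Matrix.single k l (1 : ℂ) := by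
  conv_lhs => rw [Matrix.matrix_eq_sum_single X]
  simp

theorem eq_sum_unitMap (H : Op a →ₗ[ℂ] Op b) :
    H = ∑ k, ∑ l, ∑ i, ∑ j, H (Matrix.single k l 1) i j • unitMap i j k l := by
  ext1 X
  conv_lhs => rw [op_eq_sum_single X]
  simp only [map_sum, LinearMap.sum_apply, map_smul, LinearMap.smul_apply, unitMap_apply]
  refine Finset.sum_congr rfl fun k _ => Finset.sum_congr rfl fun l _ => ?_
  conv_lhs => rw [op_eq_sum_single (H (Matrix.single k l 1))]
  simp only [Finset.smul_sum]
  refine Finset.sum_congr rfl fun i _ => Finset.sum_congr rfl fun j _ => ?_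
  rw [smul_comm]

theorem tensorMap_unitMap (i j : a') (k l : a) (i' j' : b') (k' l' : b) :
    tensorMap (unitMap i j k l) (unitMap i' j' k' l') = unitMap (i, i') (j, j') (k, k') (l, l') :=
  op_prod_ext fun X Y => by
    simp only [tensorMap_kronecker, unitMap_apply, single_eq_kronecker, Matrix.kronecker_apply,
      Matrix.smul_kronecker, Matrix.kronecker_smul, smul_smul, mul_comm]

/-- Linear maps on superoperators agree when they agree on tensor products. -/
theorem superop_ext {V : Type*} [AddCommMonoid V] [Module ℂ V]
    {Φ Ψ : (Op (a × b) →ₗ[ℂ] Op (a' × b')) →ₗ[ℂ] V}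
    (h : ∀ E F, Φ (tensorMap E F) = Ψ (tensorMap E F)) : Φ = Ψ := by
  ext1 H
  rw [eq_sum_unitMap H]
  simp only [map_sum, map_smul]
  refine Finset.sum_congr rfl fun k _ => Finset.sum_congr rfl fun l _ =>
    Finset.sum_congr rfl fun i _ => Finset.sum_congr rfl fun j _ => ?_
  rw [← tensorMap_unitMap, h]

end TensorMap

/-! ### Kraus representations and closure properties of completely positive maps -/

section Kraus

variable {a b c e a' b' : Type}
  [Fintype a] [DecidableEq a] [Fintype b] [DecidableEq b] [Fintype c] [DecidableEq c]
  [Fintype e] [DecidableEq e] [Fintype a'] [DecidableEq a'] [Fintype b'] [DecidableEq b']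

theorem conjMap_single (U : Matrix b a ℂ) (k l : a) (i j : b) :
    conjMap U (Matrix.single k l 1) i j = U i k * star (U j l) := by
  rw [conjMap_apply, Matrix.mul_apply, Finset.sum_eq_single l]
  · simp
  · intro m _ hm
    simp [Matrix.mul_single_apply_of_ne _ _ _ _ _ hm]
  · simp

theorem posSemidef_conjMap (U : Matrix b a ℂ) {X : Op a} (hX : X.PosSemidef) :
    (conjMap U X).PosSemidef := hX.mul_mul_conjTranspose_same U

/-- A linear map is completely positive iff it has an operator-sum representation. -/
theorem isCP_iff_exists_kraus (E : Op a →ₗ[ℂ] Op b) :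
    IsCP E ↔ ∃ (ι : Type) (_ : Fintype ι) (K : ι → Matrix b a ℂ), E = ∑ t, conjMap (K t) := by
  constructor
  · intro hE
    -- The Choi matrix comes from the unnormalized maximally entangled vector. Reference systems in
    -- `IsCP` are of the form `Fin r`, hence the relabelling `ε`.
    let ε := Fintype.equivFin a
    let v : Fin (Fintype.card a) × a → ℂ := fun p => if p.1 = ε p.2 then 1 else 0
    have hv : Matrix.vecMulVec v (star v)
        = ∑ k, ∑ l, (Matrix.single (ε k) (ε l) (1 : ℂ)) ⊗ₖ (Matrix.single k l (1 : ℂ)) := by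
      ext ⟨p, q⟩ ⟨p', q'⟩
      simp only [Matrix.vecMulVec_apply, v, Pi.star_apply, Matrix.sum_apply,
        Matrix.kronecker_apply, Matrix.single_apply]
      rw [Finset.sum_eq_single q, Finset.sum_eq_single q'] <;> simp +contextual [eq_comm, apply_ite]
      tauto
    have hJ := hE _ _ (Matrix.posSemidef_vecMulVec_self_star v)
    rw [hv] at hJ
    simp only [map_sum, tensorMap_kronecker, LinearMap.id_apply] at hJ
    -- Factoring the Choi matrix as `B† B`, the conjugated rows of `B`, reshaped into matrices, are
    -- Kraus operators.
    obtain ⟨B, hB⟩ := CStarAlgebra.nonneg_iff_eq_star_mul_self.mp hJ.nonneg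
    refine ⟨_, inferInstance, fun t => Matrix.of fun i k => star (B t (ε k, i)), ?_⟩
    refine op_ext fun k l => ?_
    ext i j
    have h := congrFun (congrFun hB (ε k, i)) (ε l, j)
    simp only [Matrix.sum_apply, Matrix.kronecker_apply, Matrix.single_apply,
      EmbeddingLike.apply_eq_iff_eq] at h
    rw [Finset.sum_eq_single k, Finset.sum_eq_single l] at h
    · simp only [and_self, if_true, one_mul] at h
      rw [h, Matrix.mul_apply, LinearMap.sum_apply, Matrix.sum_apply]
      refine Finset.sum_congr rfl fun t _ => ?_
      rw [conjMap_single]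
      simp [Matrix.star_apply]
    all_goals simp +contextual
  · rintro ⟨ι, _, K, rfl⟩ r X hX
    rw [tensorMap_sum_right, LinearMap.sum_apply]
    refine Matrix.posSemidef_sum _ fun t _ => ?_
    rw [← conjMap_one, tensorMap_conjMap]
    exact posSemidef_conjMap _ hX

theorem isCP_conjMap (K : Matrix b a ℂ) : IsCP (conjMap K) :=
  (isCP_iff_exists_kraus _).2 ⟨Unit, inferInstance, fun _ => K, by simp⟩

theorem isCP_zero : IsCP (0 : Op a →ₗ[ℂ] Op b) :=
  (isCP_iff_exists_kraus _).2 ⟨Empty, inferInstance, fun _ => 0, by simp⟩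

theorem IsCP.add {E F : Op a →ₗ[ℂ] Op b} (hE : IsCP E) (hF : IsCP F) : IsCP (E + F) := by
  obtain ⟨ι, _, K, rfl⟩ := (isCP_iff_exists_kraus _).1 hE
  obtain ⟨κ, _, M, rfl⟩ := (isCP_iff_exists_kraus _).1 hF
  exact (isCP_iff_exists_kraus _).2 ⟨ι ⊕ κ, inferInstance, Sum.elim K M, by simp⟩

theorem isCP_sum {ι : Type*} (s : Finset ι) {E : ι → Op a →ₗ[ℂ] Op b} (hE : ∀ i, IsCP (E i)) :
    IsCP (∑ i ∈ s, E i) :=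
  Finset.sum_induction _ _ (fun _ _ => IsCP.add) isCP_zero fun i _ => hE i

theorem conjMap_smul (r : ℂ) (K : Matrix b a ℂ) : conjMap (r • K) = (r * star r) • conjMap K := by
  ext1 X
  simp [conjMap_apply, smul_smul, mul_comm]

theorem IsCP.smul {E : Op a →ₗ[ℂ] Op b} (hE : IsCP E) {r : ℝ} (hr : 0 ≤ r) :
    IsCP ((r : ℂ) • E) := by
  obtain ⟨ι, _, K, rfl⟩ := (isCP_iff_exists_kraus _).1 hE
  refine (isCP_iff_exists_kraus _).2 ⟨ι, inferInstance, fun t => (Real.sqrt r : ℂ) • K t, ?_⟩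
  rw [Finset.smul_sum]
  refine Finset.sum_congr rfl fun t _ => ?_
  rw [conjMap_smul]
  congr 1
  rw [Complex.star_def, Complex.conj_ofReal, ← Complex.ofReal_mul, Real.mul_self_sqrt hr]

theorem IsCP.comp {E : Op a →ₗ[ℂ] Op b} {F : Op b →ₗ[ℂ] Op c} (hF : IsCP F) (hE : IsCP E) :
    IsCP (F ∘ₗ E) := by
  obtain ⟨ι, _, K, rfl⟩ := (isCP_iff_exists_kraus _).1 hE
  obtain ⟨κ, _, M, rfl⟩ := (isCP_iff_exists_kraus _).1 hF
  refine (isCP_iff_exists_kraus _).2 ⟨κ × ι, inferInstance, fun p => M p.1 * K p.2, ?_⟩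
  ext1 X
  simp only [LinearMap.sum_apply, LinearMap.comp_apply, map_sum, ← conjMap_comp,
    Fintype.sum_prod_type]
  exact Finset.sum_comm

theorem IsCP.tensorMap {E : Op a →ₗ[ℂ] Op a'} {F : Op b →ₗ[ℂ] Op b'} (hE : IsCP E)
    (hF : IsCP F) : IsCP (tensorMap E F) := by
  obtain ⟨ι, _, K, rfl⟩ := (isCP_iff_exists_kraus _).1 hE
  obtain ⟨κ, _, M, rfl⟩ := (isCP_iff_exists_kraus _).1 hF
  refine (isCP_iff_exists_kraus _).2 ⟨ι × κ, inferInstance, fun p => K p.1 ⊗ₖ M p.2, ?_⟩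
  simp only [tensorMap_sum_left, tensorMap_sum_right, tensorMap_conjMap, Fintype.sum_prod_type]
  exact Finset.sum_comm

theorem IsCP.posSemidef {E : Op a →ₗ[ℂ] Op b} (hE : IsCP E) {X : Op a} (hX : X.PosSemidef) :
    (E X).PosSemidef := by
  obtain ⟨ι, _, K, rfl⟩ := (isCP_iff_exists_kraus _).1 hE
  rw [LinearMap.sum_apply]
  exact Matrix.posSemidef_sum _ fun t _ => posSemidef_conjMap _ hX

theorem isCP_id : IsCP (LinearMap.id : Op a →ₗ[ℂ] Op a) := by
  rw [← conjMap_one]; exact isCP_conjMap _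

theorem IsChannel.comp {E : Op a →ₗ[ℂ] Op b} {F : Op b →ₗ[ℂ] Op c} (hF : IsChannel F)
    (hE : IsChannel E) : IsChannel (F ∘ₗ E) :=
  ⟨hF.1.comp hE.1, fun X => by rw [LinearMap.comp_apply, hF.2, hE.2]⟩

theorem isChannel_id : IsChannel (LinearMap.id : Op a →ₗ[ℂ] Op a) := ⟨isCP_id, fun _ => rfl⟩

/-- Equality of output traces, as an equality of linear functionals. -/
theorem trace_comp_eq_iff {E : Op a →ₗ[ℂ] Op b} {F : Op a →ₗ[ℂ] Op c} :
    (∀ X, (E X).trace = (F X).trace) ↔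
      Matrix.traceLinearMap b ℂ ℂ ∘ₗ E = Matrix.traceLinearMap c ℂ ℂ ∘ₗ F :=
  ⟨fun h => LinearMap.ext h, fun h => LinearMap.congr_fun h⟩

theorem trace_tensorMap {E : Op a →ₗ[ℂ] Op a'} {F : Op b →ₗ[ℂ] Op b'}
    (hE : ∀ X, (E X).trace = X.trace) (hF : ∀ X, (F X).trace = X.trace) (X : Op (a × b)) :
    (tensorMap E F X).trace = X.trace := by
  revert X
  refine trace_comp_eq_iff (F := LinearMap.id).2 (op_prod_ext fun X Y => ?_)
  simp [Matrix.trace_kronecker, hE, hF]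

theorem IsChannel.tensorMap {E : Op a →ₗ[ℂ] Op a'} {F : Op b →ₗ[ℂ] Op b'} (hE : IsChannel E)
    (hF : IsChannel F) : IsChannel (tensorMap E F) :=
  ⟨hE.1.tensorMap hF.1, trace_tensorMap hE.2 hF.2⟩

theorem IsChannel.isState {E : Op a →ₗ[ℂ] Op b} (hE : IsChannel E) {ρ : Op a} (hρ : IsState ρ) :
    IsState (E ρ) := ⟨hE.1.posSemidef hρ.1, by rw [hE.2, hρ.2]⟩

theorem isChannel_sum_conjMap {ι : Type} [Fintype ι] {K : ι → Matrix b a ℂ}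
    (hK : ∑ t, (K t)ᴴ * K t = 1) : IsChannel (∑ t, conjMap (K t)) := by
  refine ⟨isCP_sum _ fun t => isCP_conjMap _, fun X => ?_⟩
  simp only [LinearMap.sum_apply, Matrix.trace_sum, conjMap_apply]
  simp_rw [Matrix.trace_mul_comm _ ((K _)ᴴ), ← Matrix.mul_assoc, ← Matrix.trace_sum,
    ← Finset.sum_mul, hK, one_mul]

theorem isChannel_conjMap {U : Matrix b a ℂ} (hU : Uᴴ * U = 1) : IsChannel (conjMap U) := by
  simpa using isChannel_sum_conjMap (ι := Unit) (K := fun _ => U) (by simpa using hU)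

end Kraus

/-! ### LOCC maps: trace preservation, local post-processing, symmetrization -/

section LOCC

variable {a b c e a' b' a'' b'' m : Type}
  [Fintype a] [DecidableEq a] [Fintype b] [DecidableEq b] [Fintype c] [DecidableEq c]
  [Fintype e] [DecidableEq e] [Fintype a'] [DecidableEq a'] [Fintype b'] [DecidableEq b']
  [Fintype a''] [DecidableEq a''] [Fintype b''] [DecidableEq b''] [Fintype m] [DecidableEq m]

theorem isChannel_of_instrument {n : ℕ} {E : Fin n → Op a →ₗ[ℂ] Op b}
    (hE : ∀ x, IsCP (E x)) (hE' : ∀ X, ∑ x, (E x X).trace = X.trace)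
    {L : Fin n → Op b →ₗ[ℂ] Op c} (hL : ∀ x, IsChannel (L x)) : IsChannel (∑ x, L x ∘ₗ E x) := by
  refine ⟨isCP_sum _ fun x => (hL x).1.comp (hE x), fun X => ?_⟩
  simp only [LinearMap.sum_apply, Matrix.trace_sum, LinearMap.comp_apply, (hL _).2, hE']

theorem IsInstrument.trace_tensorMap_id {n : ℕ} {E : Fin n → Op a →ₗ[ℂ] Op m}
    (hE : IsInstrument E) (X : Op (a × b)) :
    ∑ x, (tensorMap (E x) (LinearMap.id : Op b →ₗ[ℂ] Op b) X).trace = X.trace := by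
  rw [← Matrix.trace_sum, ← LinearMap.sum_apply, ← tensorMap_sum_left]
  refine trace_tensorMap (fun X => ?_) (fun _ => rfl) X
  rw [LinearMap.sum_apply, Matrix.trace_sum, hE.2]

theorem IsInstrument.trace_id_tensorMap {n : ℕ} {F : Fin n → Op b →ₗ[ℂ] Op m}
    (hF : IsInstrument F) (X : Op (a × b)) :
    ∑ x, (tensorMap (LinearMap.id : Op a →ₗ[ℂ] Op a) (F x) X).trace = X.trace := by
  rw [← Matrix.trace_sum, ← LinearMap.sum_apply, ← tensorMap_sum_right]
  refine trace_tensorMap (fun _ => rfl) (fun X => ?_) X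
  rw [LinearMap.sum_apply, Matrix.trace_sum, hF.2]

theorem IsLOCC.isChannel {L : Op (a × b) →ₗ[ℂ] Op (a' × b')} (hL : IsLOCC L) : IsChannel L := by
  induction hL with
  | local_channels E F hE hF => exact hE.tensorMap hF
  | alice_measures E hE L _ ih =>
    exact isChannel_of_instrument (fun x => (hE.1 x).tensorMap isCP_id) hE.trace_tensorMap_id ih
  | bob_measures F hF L _ ih =>
    exact isChannel_of_instrument (fun x => isCP_id.tensorMap (hF.1 x)) hF.trace_id_tensorMap ih

/-- Local post-processing of an LOCC map is LOCC. -/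
theorem IsLOCC.comp_left {L : Op (a × b) →ₗ[ℂ] Op (a' × b')} (hL : IsLOCC L)
    {E : Op a' →ₗ[ℂ] Op a''} {F : Op b' →ₗ[ℂ] Op b''} (hE : IsChannel E) (hF : IsChannel F) :
    IsLOCC (tensorMap E F ∘ₗ L) := by
  induction hL with
  | local_channels E' F' hE' hF' =>
    rw [tensorMap_comp]
    exact .local_channels _ _ (hE.comp hE') (hF.comp hF')
  | alice_measures E' hE' L _ ih =>
    convert IsLOCC.alice_measures E' hE' _ ih using 1
    ext1 X
    simp
  | bob_measures F' hF' L _ ih =>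
    convert IsLOCC.bob_measures F' hF' _ ih using 1
    ext1 X
    simp

/-- The partial trace over the second factor. -/
def discardSnd (a b : Type) [Fintype a] [DecidableEq a] [Fintype b] [DecidableEq b] :
    Op (a × b) →ₗ[ℂ] Op a :=
  ∑ s : b, conjMap (Matrix.of fun i p => if p = (i, s) then 1 else 0)

theorem isChannel_discardSnd : IsChannel (discardSnd a b) := by
  refine isChannel_sum_conjMap ?_
  ext p q
  simp only [Matrix.sum_apply, Matrix.mul_apply, Matrix.conjTranspose_apply, Matrix.of_apply]
  rw [Finset.sum_eq_single p.2, Finset.sum_eq_single p.1]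
  · simp [Matrix.one_apply, eq_comm]
  · intro i _ hi
    simp [Prod.ext_iff, hi.symm]
  · simp
  · intro s _ hs
    simp [Prod.ext_iff, hs.symm]
  · simp

/-- A symmetrized LOCC map: Alice and Bob apply jointly random local unitaries before and
corresponding channels after the map. -/
theorem IsLOCC.twirl {L : Op (a × b) →ₗ[ℂ] Op (a' × b')} (hL : IsLOCC L) {n n' : ℕ}
    {E : Fin n → Op a →ₗ[ℂ] Op a} (hE : IsInstrument E)
    {F : Fin n' → Op b →ₗ[ℂ] Op b} (hF : IsInstrument F)
    {G : Fin n' → Op a' →ₗ[ℂ] Op a''} (hG : ∀ y, IsChannel (G y))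
    {H : Fin n → Op b' →ₗ[ℂ] Op b''} (hH : ∀ x, IsChannel (H x)) :
    IsLOCC (∑ x, ∑ y, tensorMap (G y) (H x) ∘ₗ L ∘ₗ tensorMap (E x) (F y)) := by
  -- Both outcomes are public once Bob has announced his, so Alice's correction `G y` may depend on
  -- Bob's outcome and Bob's `H x` on Alice's.
  have := IsLOCC.alice_measures E hE _ fun x =>
    IsLOCC.bob_measures F hF _ fun y => hL.comp_left (hG y) (hH x)
  convert this using 1
  ext1 X
  simp [tensorMap_comp_apply]

end LOCC

/-! ### Twirls over diagonal phases and permutations -/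

section Twirl

variable {c : Type} [Fintype c] [DecidableEq c]

/-- The map `X ↦ Tr[X] I`. -/
def traceOut (c : Type) [Fintype c] [DecidableEq c] : Op c →ₗ[ℂ] Op c :=
  (LinearMap.toSpanSingleton ℂ (Op c) 1) ∘ₗ Matrix.traceLinearMap c ℂ ℂ

theorem traceOut_apply (X : Op c) : traceOut c X = X.trace • (1 : Op c) := rfl

/-- The completely dephasing map, which erases the off-diagonal entries. -/
def dephase (c : Type) [Fintype c] [DecidableEq c] : Op c →ₗ[ℂ] Op c :=
  Matrix.diagonalLinearMap c ℂ ℂ ∘ₗ Matrix.diagLinearMap c ℂ ℂ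

theorem dephase_apply (X : Op c) : dephase c X = Matrix.diagonal X.diag := rfl

/-- The action `E ↦ U E(U† · U) U†` on superoperators. -/
def adAct (U : Op c) : (Op c →ₗ[ℂ] Op c) →ₗ[ℂ] (Op c →ₗ[ℂ] Op c) where
  toFun E := conjMap U ∘ₗ E ∘ₗ conjMap Uᴴ
  map_add' E F := by ext1 X; simp
  map_smul' r E := by ext1 X; simp

theorem adAct_apply (U : Op c) (E : Op c →ₗ[ℂ] Op c) :
    adAct U E = conjMap U ∘ₗ E ∘ₗ conjMap Uᴴ := rfl

theorem adAct_mul (U V : Op c) (E : Op c →ₗ[ℂ] Op c) : adAct U (adAct V E) = adAct (U * V) E := by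
  simp only [adAct_apply, Matrix.conjTranspose_mul, ← conjMap_comp, LinearMap.comp_assoc]

theorem adAct_one (E : Op c →ₗ[ℂ] Op c) : adAct 1 E = E := by
  simp [adAct_apply, conjMap_one]

theorem adAct_id {U : Op c} (hU : Uᴴ * U = 1) : adAct U LinearMap.id = LinearMap.id := by
  rw [adAct_apply, LinearMap.id_comp, conjMap_comp, mul_eq_one_comm.1 hU, conjMap_one]

theorem trace_conjMap {U : Op c} (hU : Uᴴ * U = 1) (X : Op c) : (conjMap U X).trace = X.trace :=
  (isChannel_conjMap hU).2 X

theorem adAct_traceOut {U : Op c} (hU : Uᴴ * U = 1) : adAct U (traceOut c) = traceOut c := by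
  have hU' := mul_eq_one_comm.1 hU
  ext1 X
  simp only [adAct_apply, LinearMap.comp_apply, traceOut_apply, map_smul]
  rw [trace_conjMap (by simpa using hU'), conjMap_apply, Matrix.mul_one, hU']

/-- A probability distribution `p` over unitaries `U`. -/
structure IsUnitaryMixture {ι : Type} [Fintype ι] (p : ι → ℝ) (U : ι → Op c) : Prop where
  nonneg : ∀ i, 0 ≤ p i
  sum_eq_one : ∑ i, p i = 1
  unitary : ∀ i, (U i)ᴴ * U i = 1

/-- The average of `adAct` over a distribution of unitaries. -/
def twirl {ι : Type} [Fintype ι] (p : ι → ℝ) (U : ι → Op c) :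
    (Op c →ₗ[ℂ] Op c) →ₗ[ℂ] (Op c →ₗ[ℂ] Op c) := ∑ i, (p i : ℂ) • adAct (U i)

theorem twirl_apply {ι : Type} [Fintype ι] (p : ι → ℝ) (U : ι → Op c) (E : Op c →ₗ[ℂ] Op c) :
    twirl p U E = ∑ i, (p i : ℂ) • adAct (U i) E := by
  simp only [twirl, LinearMap.sum_apply, LinearMap.smul_apply]

theorem twirl_twirl {ι κ : Type} [Fintype ι] [Fintype κ] (p : ι → ℝ) (U : ι → Op c)
    (q : κ → ℝ) (V : κ → Op c) (E : Op c →ₗ[ℂ] Op c) :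
    twirl p U (twirl q V E)
      = twirl (fun x : ι × κ => p x.1 * q x.2) (fun x => U x.1 * V x.2) E := by
  simp only [twirl_apply, map_sum, map_smul, adAct_mul, Fintype.sum_prod_type, Finset.smul_sum,
    smul_smul, Complex.ofReal_mul]
  rw [Finset.sum_comm]
  simp only [mul_comm]

theorem IsUnitaryMixture.mul {ι κ : Type} [Fintype ι] [Fintype κ] {p : ι → ℝ} {U : ι → Op c}
    {q : κ → ℝ} {V : κ → Op c} (h : IsUnitaryMixture p U) (h' : IsUnitaryMixture q V) :
    IsUnitaryMixture (fun x : ι × κ => p x.1 * q x.2) (fun x => U x.1 * V x.2) where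
  nonneg x := mul_nonneg (h.nonneg _) (h'.nonneg _)
  sum_eq_one := by
    simp only [Fintype.sum_prod_type, ← Finset.mul_sum, h'.sum_eq_one, mul_one, h.sum_eq_one]
  unitary x := by
    rw [Matrix.conjTranspose_mul, Matrix.mul_assoc, ← Matrix.mul_assoc (U x.1)ᴴ, h.unitary,
      Matrix.one_mul, h'.unitary]

theorem IsUnitaryMixture.twirl_id {ι : Type} [Fintype ι] {p : ι → ℝ} {U : ι → Op c}
    (h : IsUnitaryMixture p U) : twirl p U LinearMap.id = LinearMap.id := by
  simp only [twirl_apply, adAct_id (h.unitary _), ← Finset.sum_smul, ← Complex.ofReal_sum,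
    h.sum_eq_one, Complex.ofReal_one, one_smul]

theorem IsUnitaryMixture.twirl_traceOut {ι : Type} [Fintype ι] {p : ι → ℝ} {U : ι → Op c}
    (h : IsUnitaryMixture p U) : twirl p U (traceOut c) = traceOut c := by
  simp only [twirl_apply, adAct_traceOut (h.unitary _), ← Finset.sum_smul, ← Complex.ofReal_sum,
    h.sum_eq_one, Complex.ofReal_one, one_smul]

theorem IsUnitaryMixture.exists_fin {ι : Type} [Fintype ι] {p : ι → ℝ} {U : ι → Op c}
    (h : IsUnitaryMixture p U) : ∃ (n : ℕ) (q : Fin n → ℝ) (V : Fin n → Op c),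
      IsUnitaryMixture q V ∧ twirl q V = twirl p U := by
  let ε := (Fintype.equivFin ι).symm
  refine ⟨_, p ∘ ε, U ∘ ε, ⟨fun i => h.nonneg _, ?_, fun i => h.unitary _⟩, ?_⟩
  · rw [← h.sum_eq_one]; exact ε.sum_comp p
  · exact ε.sum_comp fun i => (p i : ℂ) • adAct (U i)

/-- Superoperators with equal matrix elements are equal. -/
theorem superop_ext_entry {E F : Op c →ₗ[ℂ] Op c}
    (h : ∀ i j k l, E (Matrix.single k l 1) i j = F (Matrix.single k l 1) i j) : E = F :=
  op_ext fun k l => by ext i j; exact h i j k l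

theorem id_entry (i j k l : c) :
    (LinearMap.id : Op c →ₗ[ℂ] Op c) (Matrix.single k l 1) i j = if i = k ∧ j = l then 1 else 0 := by
  simp [Matrix.single_apply, eq_comm]

theorem traceOut_entry (i j k l : c) :
    traceOut c (Matrix.single k l 1) i j = if i = j ∧ k = l then 1 else 0 := by
  rw [traceOut_apply]
  by_cases h : k = l <;> by_cases h' : i = j <;> simp [Matrix.trace_single_eq_of_ne, h, h']

theorem dephase_entry (i j k l : c) :
    dephase c (Matrix.single k l 1) i j = if i = j ∧ i = k ∧ i = l then 1 else 0 := by
  rw [dephase_apply]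
  by_cases h' : i = j
  · subst h'; simp [Matrix.single_apply, eq_comm]
  · simp [h']

section Phases

instance fintypeRootsOfUnityFour : Fintype (rootsOfUnity 4 ℂ) := Fintype.ofFinite _

/-- Fourth roots of unity as phases. -/
abbrev PhaseGroup (c : Type) := c → rootsOfUnity 4 ℂ

/-- The phase at a given position. -/
def phase (φ : PhaseGroup c) (i : c) : ℂ := ((φ i : ℂˣ) : ℂ)

theorem phase_mul (φ ψ : PhaseGroup c) (i : c) : phase (φ * ψ) i = phase φ i * phase ψ i := by
  simp [phase]

theorem phase_mul_star (φ : PhaseGroup c) (i : c) : phase φ i * star (phase φ i) = 1 := by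
  have h : phase φ i ^ 4 = 1 := by
    have := (φ i).2
    rw [mem_rootsOfUnity] at this
    have := congrArg Units.val this
    simpa [phase] using this
  have h1 : ‖phase φ i‖ = 1 := Complex.norm_eq_one_of_pow_eq_one h (by norm_num)
  rw [Complex.star_def, Complex.mul_conj, Complex.normSq_eq_norm_sq, h1]
  norm_num

/-- The product of phases by which a diagonal unitary acts on a matrix element. -/
def phaseWeight (i j k l : c) (φ : PhaseGroup c) : ℂ :=
  phase φ i * star (phase φ j) * star (phase φ k) * phase φ l

theorem phaseWeight_mul (i j k l : c) (φ ψ : PhaseGroup c) :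
    phaseWeight i j k l (φ * ψ) = phaseWeight i j k l φ * phaseWeight i j k l ψ := by
  simp only [phaseWeight, phase_mul, star_mul']; ring

/-- The phase that equals the imaginary unit at `t` and `1` elsewhere. -/
def singlePhase (t : c) : PhaseGroup c :=
  Pi.mulSingle t ⟨Units.mk0 Complex.I Complex.I_ne_zero, by
    rw [mem_rootsOfUnity]; ext; simp⟩

theorem phase_singlePhase (t i : c) :
    phase (singlePhase t) i = if i = t then Complex.I else 1 := by
  unfold phase singlePhase
  by_cases h : i = t
  · subst h; simp
  · simp [h]

/-- A single phase `I` at a well-chosen position suffices. Signs would not: for `i = l` and `j = k`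
the weight is a product of squares, which is why fourth roots of unity are used. -/
theorem exists_phaseWeight_ne_one {i j k l : c} (h : ¬ ((i = k ∧ j = l) ∨ (i = j ∧ k = l))) :
    ∃ φ, phaseWeight i j k l φ ≠ 1 := by
  have hI : Complex.I ≠ 1 := fun h => by simpa using congrArg Complex.re h
  have hI2 : (-1 : ℂ) ≠ 1 := by norm_num
  have hI' : -Complex.I ≠ 1 := fun h => by simpa using congrArg Complex.re h
  push Not at h
  by_cases hik : i = k
  · subst hik
    refine ⟨singlePhase j, ?_⟩
    have hjl := h.1 rfl
    simp only [phaseWeight, phase_singlePhase]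
    by_cases hij : i = j <;> simp_all [eq_comm]
  · by_cases hij : i = j
    · subst hij
      refine ⟨singlePhase k, ?_⟩
      have hkl := h.2 rfl
      simp_all [phaseWeight, phase_singlePhase, eq_comm]
    · refine ⟨singlePhase i, ?_⟩
      by_cases hil : i = l <;> simp_all [phaseWeight, phase_singlePhase, eq_comm]

/-- Character orthogonality: `phaseWeight i j k l` is a character of the phase group, trivial
exactly for the two index patterns listed. -/
theorem sum_phaseWeight (i j k l : c) :
    ∑ φ : PhaseGroup c, phaseWeight i j k l φ
      = if (i = k ∧ j = l) ∨ (i = j ∧ k = l) then (Fintype.card (PhaseGroup c) : ℂ) else 0 := by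
  split_ifs with h
  · have : ∀ φ : PhaseGroup c, phaseWeight i j k l φ = 1 := fun φ => by
      have hu := phase_mul_star φ
      rcases h with ⟨rfl, rfl⟩ | ⟨rfl, rfl⟩
      · calc _ = (phase φ i * star (phase φ i)) * (phase φ j * star (phase φ j)) := by
              simp only [phaseWeight]; ring
          _ = 1 := by rw [hu, hu, one_mul]
      · calc _ = (phase φ i * star (phase φ i)) * (phase φ k * star (phase φ k)) := by
              simp only [phaseWeight]; ring
          _ = 1 := by rw [hu, hu, one_mul]
    simp [this]
  · obtain ⟨ψ, hψ⟩ := exists_phaseWeight_ne_one h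
    have := Fintype.sum_equiv (Equiv.mulLeft ψ)
      (fun φ => phaseWeight i j k l (ψ * φ)) (phaseWeight i j k l) fun φ => rfl
    simp only [phaseWeight_mul, ← Finset.mul_sum] at this
    by_contra hne
    exact hψ (mul_right_cancel₀ hne (this.trans (one_mul _).symm))

theorem adAct_diagonal_entry (u : c → ℂ) (E : Op c →ₗ[ℂ] Op c) (i j k l : c) :
    adAct (Matrix.diagonal u) E (Matrix.single k l 1) i j
      = u i * star (u j) * star (u k) * u l * E (Matrix.single k l 1) i j := by
  have h : conjMap (Matrix.diagonal u)ᴴ (Matrix.single k l 1)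
      = (star (u k) * u l) • Matrix.single k l (1 : ℂ) := by
    ext i j
    simp only [conjMap_apply, Matrix.diagonal_conjTranspose, Matrix.diagonal_mul,
      Matrix.mul_diagonal, Matrix.smul_apply, Matrix.single_apply, Pi.star_apply, star_star]
    split_ifs with h
    · simp [h.1, h.2]
    · simp
  simp only [adAct_apply, LinearMap.comp_apply, h, map_smul]
  simp only [conjMap_apply, Matrix.diagonal_conjTranspose, Matrix.diagonal_mul,
      Matrix.mul_diagonal, Matrix.smul_apply, Pi.star_apply, smul_eq_mul]
  ring

/-- The twirl over diagonal unitaries. -/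
def phaseTwirl (c : Type) [Fintype c] [DecidableEq c] :
    (Op c →ₗ[ℂ] Op c) →ₗ[ℂ] (Op c →ₗ[ℂ] Op c) :=
  twirl (fun _ : PhaseGroup c => (Fintype.card (PhaseGroup c) : ℝ)⁻¹)
    fun φ => Matrix.diagonal (phase φ)

theorem isUnitaryMixture_phase : IsUnitaryMixture
    (fun _ : PhaseGroup c => (Fintype.card (PhaseGroup c) : ℝ)⁻¹)
    (fun φ => Matrix.diagonal (phase φ)) where
  nonneg _ := by positivity
  sum_eq_one := by simp
  unitary φ := by
    rw [Matrix.diagonal_conjTranspose, Matrix.diagonal_mul_diagonal, ← Matrix.diagonal_one]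
    congr 1
    ext i
    rw [Pi.star_apply, mul_comm, phase_mul_star]

theorem phaseTwirl_entry (E : Op c →ₗ[ℂ] Op c) (i j k l : c) :
    phaseTwirl c E (Matrix.single k l 1) i j
      = if (i = k ∧ j = l) ∨ (i = j ∧ k = l) then E (Matrix.single k l 1) i j else 0 := by
  have h := sum_phaseWeight i j k l
  rw [phaseTwirl, twirl_apply]
  simp only [LinearMap.sum_apply, LinearMap.smul_apply, Matrix.sum_apply, Matrix.smul_apply,
    adAct_diagonal_entry, smul_eq_mul, ← Finset.mul_sum, ← Finset.sum_mul]
  simp only [phaseWeight] at h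
  rw [h]
  split_ifs
  · rw [← mul_assoc, Complex.ofReal_inv, Complex.ofReal_natCast,
      inv_mul_cancel₀ (Nat.cast_ne_zero.2 Fintype.card_ne_zero), one_mul]
  · simp

end Phases

section Permutations

/-- The permutation matrix with `P X P† = X ∘ (σ × σ)`. -/
def permOp (σ : Equiv.Perm c) : Op c := (1 : Op c).submatrix σ id

theorem conjTranspose_permOp (σ : Equiv.Perm c) : (permOp σ)ᴴ = permOp σ⁻¹ := by
  ext i j
  simp only [permOp, Matrix.conjTranspose_apply, Matrix.submatrix_apply, Matrix.one_apply, id]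
  by_cases h : σ j = i
  · subst h; simp
  · have h' : ¬ σ⁻¹ i = j := by rwa [Equiv.Perm.inv_eq_iff_eq, eq_comm]
    rw [if_neg h, if_neg h', star_zero]

theorem conjMap_permOp (σ : Equiv.Perm c) (X : Op c) : conjMap (permOp σ) X = X.submatrix σ σ := by
  rw [conjMap_apply]
  ext i j
  simp [permOp, Matrix.mul_apply, Matrix.one_apply]

theorem permOp_unitary (σ : Equiv.Perm c) : (permOp σ)ᴴ * permOp σ = 1 := by
  have h := conjMap_permOp σ⁻¹ 1
  rw [conjMap_apply, Matrix.mul_one, conjTranspose_permOp, inv_inv,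
    Matrix.submatrix_one_equiv] at h
  rw [conjTranspose_permOp, h]

theorem adAct_permOp_entry (σ : Equiv.Perm c) (E : Op c →ₗ[ℂ] Op c) (i j k l : c) :
    adAct (permOp σ) E (Matrix.single k l 1) i j
      = E (Matrix.single (σ k) (σ l) 1) (σ i) (σ j) := by
  simp only [adAct_apply, LinearMap.comp_apply, conjTranspose_permOp, conjMap_permOp,
    Matrix.submatrix_apply]
  simp

/-- The twirl over permutation matrices. -/
def permTwirl (c : Type) [Fintype c] [DecidableEq c] :
    (Op c →ₗ[ℂ] Op c) →ₗ[ℂ] (Op c →ₗ[ℂ] Op c) :=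
  twirl (fun _ : Equiv.Perm c => (Fintype.card (Equiv.Perm c) : ℝ)⁻¹) permOp

theorem isUnitaryMixture_perm : IsUnitaryMixture
    (fun _ : Equiv.Perm c => (Fintype.card (Equiv.Perm c) : ℝ)⁻¹) permOp where
  nonneg _ := by positivity
  sum_eq_one := by
    rw [Finset.sum_const, Finset.card_univ, nsmul_eq_mul, mul_inv_cancel₀]
    exact Nat.cast_ne_zero.2 Fintype.card_ne_zero
  unitary := permOp_unitary

/-- The average over permutations of the matrix elements of a superoperator. -/
def permMean (E : Op c →ₗ[ℂ] Op c) (i j k l : c) : ℂ :=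
  (Fintype.card (Equiv.Perm c) : ℂ)⁻¹
    * ∑ σ : Equiv.Perm c, E (Matrix.single (σ k) (σ l) 1) (σ i) (σ j)

theorem permTwirl_entry (E : Op c →ₗ[ℂ] Op c) (i j k l : c) :
    permTwirl c E (Matrix.single k l 1) i j = permMean E i j k l := by
  rw [permTwirl, twirl_apply, permMean]
  simp only [LinearMap.sum_apply, LinearMap.smul_apply, Matrix.sum_apply, Matrix.smul_apply,
    adAct_permOp_entry, smul_eq_mul, ← Finset.mul_sum, Complex.ofReal_inv, Complex.ofReal_natCast]

theorem permMean_perm (E : Op c →ₗ[ℂ] Op c) (τ : Equiv.Perm c) (i j k l : c) :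
    permMean E (τ i) (τ j) (τ k) (τ l) = permMean E i j k l := by
  rw [permMean, permMean]
  congr 1
  exact Fintype.sum_equiv (Equiv.mulRight τ) _ _ fun σ => rfl

theorem permMean_of_forall {E : Op c →ₗ[ℂ] Op c} {i j k l : c} {r : ℂ}
    (h : ∀ σ : Equiv.Perm c, E (Matrix.single (σ k) (σ l) 1) (σ i) (σ j) = r) :
    permMean E i j k l = r := by
  simp only [permMean, h, Finset.sum_const, Finset.card_univ, nsmul_eq_mul]
  rw [← mul_assoc, inv_mul_cancel₀ (Nat.cast_ne_zero.2 Fintype.card_ne_zero), one_mul]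

/-- The twirl over monomial unitaries. -/
def monomialTwirl (c : Type) [Fintype c] [DecidableEq c] :
    (Op c →ₗ[ℂ] Op c) →ₗ[ℂ] (Op c →ₗ[ℂ] Op c) := permTwirl c ∘ₗ phaseTwirl c

theorem monomialTwirl_entry (E : Op c →ₗ[ℂ] Op c) (i j k l : c) :
    monomialTwirl c E (Matrix.single k l 1) i j
      = if (i = k ∧ j = l) ∨ (i = j ∧ k = l) then permMean E i j k l else 0 := by
  rw [monomialTwirl, LinearMap.comp_apply, permTwirl_entry]
  simp only [permMean, phaseTwirl_entry, EmbeddingLike.apply_eq_iff_eq]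
  split_ifs
  · rfl
  · simp

theorem exists_perm_apply_eq {x y i j : c} (hxy : x ≠ y) (hij : i ≠ j) :
    ∃ τ : Equiv.Perm c, τ x = i ∧ τ y = j := by
  refine ⟨Equiv.swap (Equiv.swap x i y) j * Equiv.swap x i, ?_, ?_⟩
  · rw [Equiv.Perm.mul_apply, Equiv.swap_apply_left, Equiv.swap_apply_of_ne_of_ne _ hij]
    intro h
    have := (Equiv.swap x i).injective ((Equiv.swap_apply_left x i).trans h)
    exact hxy this
  · rw [Equiv.Perm.mul_apply, Equiv.swap_apply_left]

/-- After the phase twirl only entries with `(i, j) = (k, l)` or with `i = j`, `k = l` survive.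
Permutations act doubly transitively, so these entries take three values: one for each pattern off
their intersection and one on it. The dephasing term corrects the intersection, where the identity
and trace-out terms both contribute. -/
theorem monomialTwirl_eq {x y : c} (hxy : x ≠ y) (E : Op c →ₗ[ℂ] Op c) :
    monomialTwirl c E = permMean E x y x y • LinearMap.id + permMean E y y x x • traceOut c
      + (permMean E x x x x - permMean E x y x y - permMean E y y x x) • dephase c := by
  refine superop_ext_entry fun i j k l => ?_
  simp only [monomialTwirl_entry, LinearMap.add_apply, LinearMap.smul_apply, Matrix.add_apply,
    Matrix.smul_apply, smul_eq_mul]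
  rw [id_entry, traceOut_entry, dephase_entry]
  by_cases h1 : i = k ∧ j = l
  · obtain ⟨rfl, rfl⟩ := h1
    by_cases hij : i = j
    · subst hij
      have := permMean_perm E (Equiv.swap x i) x x x x
      rw [Equiv.swap_apply_left] at this
      simp [this]
    · obtain ⟨τ, rfl, rfl⟩ := exists_perm_apply_eq hxy hij
      simp [permMean_perm, hij]
  · by_cases h2 : i = j ∧ k = l
    · obtain ⟨rfl, rfl⟩ := h2
      have hik : k ≠ i := fun h => h1 ⟨h.symm, h.symm⟩
      obtain ⟨τ, rfl, rfl⟩ := exists_perm_apply_eq hxy hik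
      simp [permMean_perm, hik.symm]
    · have h3 : ¬ (i = j ∧ i = k ∧ i = l) := fun h => h1 ⟨h.2.1, h.1.symm.trans h.2.2⟩
      simp [h1, h2, h3]

theorem monomialTwirl_id : monomialTwirl c LinearMap.id = LinearMap.id := by
  rw [monomialTwirl, LinearMap.comp_apply, phaseTwirl, permTwirl, isUnitaryMixture_phase.twirl_id,
    isUnitaryMixture_perm.twirl_id]

theorem monomialTwirl_traceOut : monomialTwirl c (traceOut c) = traceOut c := by
  rw [monomialTwirl, LinearMap.comp_apply, phaseTwirl, permTwirl,
    isUnitaryMixture_phase.twirl_traceOut, isUnitaryMixture_perm.twirl_traceOut]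

end Permutations

end Twirl

/-! ### The Fourier transform and a finite unitary 2-design -/

section Fourier

variable {d : ℕ}

/-- The character `exp(2πikz/d)`. -/
def fourierChar (k z : Fin d) : ℂ :=
  Complex.exp (2 * Real.pi * Complex.I * ((k : ℕ) : ℂ) * ((z : ℕ) : ℂ) / (d : ℂ))

theorem fourierChar_eq_pow (k z : Fin d) :
    fourierChar k z = (Complex.exp (2 * Real.pi * Complex.I / d) ^ (k : ℕ)) ^ (z : ℕ) := by
  rw [fourierChar, ← Complex.exp_nat_mul, ← Complex.exp_nat_mul]
  congr 1
  ring

theorem norm_fourierChar (k z : Fin d) : ‖fourierChar k z‖ = 1 := by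
  rw [fourierChar, show (2 * Real.pi * Complex.I * ((k : ℕ) : ℂ) * ((z : ℕ) : ℂ) / (d : ℂ))
    = ((2 * Real.pi * (k : ℕ) * (z : ℕ) / d : ℝ) : ℂ) * Complex.I by push_cast; ring]
  exact Complex.norm_exp_ofReal_mul_I _

theorem fourierChar_mul_star (k z : Fin d) : fourierChar k z * star (fourierChar k z) = 1 := by
  rw [Complex.star_def, Complex.mul_conj, Complex.normSq_eq_norm_sq, norm_fourierChar]
  norm_num

/-- For `k ≠ l` this is a geometric sum whose ratio is a nontrivial `d`-th root of unity. -/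
theorem sum_fourierChar (k l : Fin d) :
    ∑ z, fourierChar k z * star (fourierChar l z) = if k = l then (d : ℂ) else 0 := by
  split_ifs with h
  · subst h; simp only [fourierChar_mul_star]; simp
  have hd : d ≠ 0 := by rintro rfl; exact k.elim0
  have hω := Complex.isPrimitiveRoot_exp d hd
  set ω := Complex.exp (2 * Real.pi * Complex.I / d) with hωdef
  have hω0 : ω ≠ 0 := Complex.exp_ne_zero _
  have hstar : ∀ z, star (fourierChar l z) = ((ω ^ (l : ℕ))⁻¹) ^ (z : ℕ) := fun z => by
    rw [inv_pow, hωdef, ← fourierChar_eq_pow]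
    exact eq_inv_of_mul_eq_one_right (fourierChar_mul_star l z)
  have hr : ω ^ (k : ℕ) * (ω ^ (l : ℕ))⁻¹ ≠ 1 := fun h' => by
    rw [mul_inv_eq_one₀ (pow_ne_zero _ hω0)] at h'
    exact h (Fin.ext (hω.pow_inj k.2 l.2 h'))
  have hrd : (ω ^ (k : ℕ) * (ω ^ (l : ℕ))⁻¹) ^ d = 1 := by
    rw [mul_pow, inv_pow, ← pow_mul, ← pow_mul, mul_comm, mul_comm (l : ℕ), mul_comm (k : ℕ),
      pow_mul, pow_mul, hω.pow_eq_one]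
    simp
  simp only [fourierChar_eq_pow k, ← hωdef, hstar, ← mul_pow]
  rw [Fin.sum_univ_eq_sum_range (fun n => (ω ^ (k : ℕ) * (ω ^ (l : ℕ))⁻¹) ^ n)]
  have := mul_geom_sum (ω ^ (k : ℕ) * (ω ^ (l : ℕ))⁻¹) d
  rw [hrd, sub_self, mul_eq_zero] at this
  exact this.resolve_left (sub_ne_zero.2 hr)

/-- The discrete Fourier transform. -/
def fourierOp (d : ℕ) : Op (Fin d) := Matrix.of fun i k => ((Real.sqrt d)⁻¹ : ℝ) * fourierChar i k

theorem sqrt_inv_mul_self (d : ℕ) :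
    (((Real.sqrt d)⁻¹ : ℝ) : ℂ) * (((Real.sqrt d)⁻¹ : ℝ) : ℂ) = (d : ℂ)⁻¹ := by
  rw [← Complex.ofReal_mul, ← mul_inv, Real.mul_self_sqrt (Nat.cast_nonneg d)]
  push_cast; rfl

theorem fourierOp_mul_star (i j k l : Fin d) :
    fourierOp d i j * star (fourierOp d k l)
      = (d : ℂ)⁻¹ * (fourierChar i j * star (fourierChar k l)) := by
  rw [← sqrt_inv_mul_self d]
  simp only [fourierOp, Matrix.of_apply, star_mul', Complex.star_def, Complex.conj_ofReal]
  ring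

theorem fourierOp_unitary (hd : d ≠ 0) : (fourierOp d)ᴴ * fourierOp d = 1 := by
  rw [mul_eq_one_comm]
  ext k l
  simp only [Matrix.mul_apply, Matrix.conjTranspose_apply, fourierOp_mul_star,
    ← Finset.mul_sum, sum_fourierChar, Matrix.one_apply]
  have : (d : ℂ) ≠ 0 := Nat.cast_ne_zero.2 hd
  split_ifs <;> simp [this]

/-- For these index patterns the four Fourier entries pair into two squared moduli `1/d`. Each of
the `d` dephasing terms thus gives `1/d²`. -/
theorem adAct_fourier_dephase_entry (hd : d ≠ 0) {i j k l : Fin d}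
    (h : (i = k ∧ j = l) ∨ (i = j ∧ k = l)) :
    adAct (fourierOp d) (dephase (Fin d)) (Matrix.single k l 1) i j = (d : ℂ)⁻¹ := by
  have hd' : (d : ℂ) ≠ 0 := Nat.cast_ne_zero.2 hd
  have h1 : ∀ X, conjMap (fourierOp d) (dephase (Fin d) X) i j
      = ∑ s, fourierOp d i s * X s s * star (fourierOp d j s) := fun X => by
    rw [conjMap_apply, dephase_apply, Matrix.mul_apply]
    simp [Matrix.mul_diagonal]
  simp only [adAct_apply, LinearMap.comp_apply, h1, conjMap_single, Matrix.conjTranspose_apply,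
    star_star]
  have h2 : ∀ s, fourierOp d i s * (star (fourierOp d k s) * fourierOp d l s)
      * star (fourierOp d j s) = (d : ℂ)⁻¹ * (d : ℂ)⁻¹ := fun s => by
    rcases h with ⟨rfl, rfl⟩ | ⟨rfl, rfl⟩
    · calc _ = (fourierOp d i s * star (fourierOp d i s))
            * (fourierOp d j s * star (fourierOp d j s)) := by ring
        _ = _ := by simp only [fourierOp_mul_star, fourierChar_mul_star, mul_one]
    · calc _ = (fourierOp d i s * star (fourierOp d i s))
            * (fourierOp d k s * star (fourierOp d k s)) := by ring
        _ = _ := by simp only [fourierOp_mul_star, fourierChar_mul_star, mul_one]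
  simp only [h2, Finset.sum_const, Finset.card_univ, Fintype.card_fin, nsmul_eq_mul]
  field_simp

theorem monomialTwirl_fourier_dephase (hd : 2 ≤ d) :
    monomialTwirl (Fin d) (adAct (fourierOp d) (dephase (Fin d)))
      = (d : ℂ)⁻¹ • (LinearMap.id + traceOut (Fin d) - dephase (Fin d)) := by
  have h0 : d ≠ 0 := by omega
  have hxy : (⟨0, by omega⟩ : Fin d) ≠ ⟨1, by omega⟩ := by simp
  rw [monomialTwirl_eq hxy]
  rw [permMean_of_forall (r := (d : ℂ)⁻¹) fun σ => adAct_fourier_dephase_entry h0 (by simp),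
    permMean_of_forall (r := (d : ℂ)⁻¹) fun σ => adAct_fourier_dephase_entry h0 (by simp),
    permMean_of_forall (r := (d : ℂ)⁻¹) fun σ => adAct_fourier_dephase_entry h0 (by simp)]
  module

theorem monomialTwirl_dephase (hd : 2 ≤ d) :
    monomialTwirl (Fin d) (dephase (Fin d)) = dephase (Fin d) := by
  have hxy : (⟨0, by omega⟩ : Fin d) ≠ ⟨1, by omega⟩ := by simp
  rw [monomialTwirl_eq hxy]
  rw [permMean_of_forall (r := 0) fun σ => by rw [dephase_entry]; simp,
    permMean_of_forall (r := 0) fun σ => by rw [dephase_entry]; simp,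
    permMean_of_forall (r := 1) fun σ => by rw [dephase_entry]; simp]
  module

/-- Some finite distribution over unitaries is a unitary 2-design. -/
theorem exists_twirl_eq (hd : 2 ≤ d) :
    ∃ (n : ℕ) (p : Fin n → ℝ) (U : Fin n → Op (Fin d)), IsUnitaryMixture p U ∧
      ∀ E, ∃ x y : ℂ, twirl p U E = x • LinearMap.id + y • traceOut (Fin d) := by
  have h0 : d ≠ 0 := by omega
  have hd1 : (d : ℂ) + 1 ≠ 0 := by exact_mod_cast Nat.succ_ne_zero d
  have hxy : (⟨0, by omega⟩ : Fin d) ≠ ⟨1, by omega⟩ := by simp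
  -- The Fourier transform sends dephasing, up to a monomial twirl, to `(id + traceOut - dephase) /
  -- d`. The odds `d : 1` against doing nothing are those for which the dephasing terms cancel.
  let q : Bool → ℝ := fun t => if t then d / (d + 1) else 1 / (d + 1)
  let V : Bool → Op (Fin d) := fun t => if t then fourierOp d else 1
  have hq : IsUnitaryMixture q V :=
    { nonneg := by intro t; cases t <;> simp only [q] <;> positivity
      sum_eq_one := by
        have : (d : ℝ) + 1 ≠ 0 := by positivity
        simp only [Fintype.sum_bool, q, if_true]
        rw [if_neg Bool.false_ne_true, ← add_div, div_self this]
      unitary := by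
        intro t; cases t
        · simp [V]
        · simpa [V] using fourierOp_unitary h0 }
  have hm := (isUnitaryMixture_perm (c := Fin d)).mul isUnitaryMixture_phase
  -- The design is a random product: monomial, then Fourier or nothing, then an independent
  -- monomial.
  obtain ⟨n, p, U, hpU, h⟩ := ((hm.mul hq).mul hm).exists_fin
  refine ⟨n, p, U, hpU, fun E => ?_⟩
  have h2 : twirl p U E = monomialTwirl _ (twirl q V (monomialTwirl _ E)) := by
    have hM : ∀ E, monomialTwirl (Fin d) E = twirl _ _ E := fun E => twirl_twirl _ _ _ _ E
    rw [h, hM, hM, twirl_twirl, twirl_twirl]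
  have hΔ : monomialTwirl _ (twirl q V (dephase (Fin d)))
      = ((d : ℂ) + 1)⁻¹ • (LinearMap.id + traceOut (Fin d)) := by
    simp only [twirl_apply, Fintype.sum_bool, q, V, if_true, Bool.false_eq_true, if_false,
      adAct_one, map_add, map_smul, monomialTwirl_dephase hd, monomialTwirl_fourier_dephase hd]
    push_cast
    rw [smul_smul, show (d : ℂ) / (d + 1) * (d : ℂ)⁻¹ = ((d : ℂ) + 1)⁻¹ by field_simp, one_div]
    module
  have hME := monomialTwirl_eq hxy E
  set x := permMean E ⟨0, _⟩ ⟨1, _⟩ ⟨0, _⟩ ⟨1, _⟩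
  set y := permMean E ⟨1, _⟩ ⟨1, _⟩ ⟨0, _⟩ ⟨0, _⟩
  set z := permMean E ⟨0, _⟩ ⟨0, _⟩ ⟨0, _⟩ ⟨0, _⟩ - x - y
  refine ⟨x + z * ((d : ℂ) + 1)⁻¹, y + z * ((d : ℂ) + 1)⁻¹, ?_⟩
  rw [h2, hME]
  simp only [map_add, map_smul, hq.twirl_id, hq.twirl_traceOut, monomialTwirl_id,
    monomialTwirl_traceOut, hΔ]
  module

end Fourier

/-! ### The garbling channel as a combination of trace-out and identity -/

section Garble

variable {d : ℕ}

theorem pauliZ_eq (z : Fin d) : pauliZ d z = Matrix.diagonal fun k => fourierChar k z := rfl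

theorem conjMap_pauliX [NeZero d] (x : Fin d) (X : Op (Fin d)) :
    conjMap (pauliX d x) X = X.submatrix (fun i => i - x) (fun i => i - x) := by
  have : pauliX d x = permOp (Equiv.subRight x) := by
    ext i k
    simp only [pauliX, permOp, Matrix.of_apply, Matrix.submatrix_apply, Matrix.one_apply, id,
      Equiv.subRight_apply, ← Fin.val_add, Fin.val_inj, sub_eq_iff_eq_add]
  rw [this, conjMap_permOp]
  rfl

/-- Summing over `z` kills the off-diagonal entries by orthogonality of characters; summing over the
shifts `x` spreads the trace over the diagonal. -/
theorem sum_conjMap_pauli (hd : d ≠ 0) (X : Op (Fin d)) :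
    ∑ p : Fin d × Fin d, conjMap (pauliZ d p.1 * pauliX d p.2) X
      = ((d : ℂ) * X.trace) • (1 : Op (Fin d)) := by
  have : NeZero d := ⟨hd⟩
  ext i j
  have h : ∀ z x : Fin d, conjMap (pauliZ d z * pauliX d x) X i j
      = (fourierChar i z * star (fourierChar j z)) * X (i - x) (j - x) := fun z x => by
    rw [← conjMap_comp, LinearMap.comp_apply, conjMap_pauliX, pauliZ_eq, conjMap_apply,
      Matrix.diagonal_conjTranspose, Matrix.mul_diagonal, Matrix.diagonal_mul]
    simp only [Matrix.submatrix_apply, Pi.star_apply]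
    ring
  simp only [Fintype.sum_prod_type, Matrix.sum_apply, h]
  rw [Finset.sum_comm]
  simp only [← Finset.sum_mul, sum_fourierChar, Matrix.smul_apply, Matrix.one_apply]
  split_ifs with hij
  · subst hij
    rw [← Finset.mul_sum, smul_eq_mul, mul_one]
    congr 1
    exact Fintype.sum_equiv (Equiv.subLeft i) _ _ fun x => rfl
  · simp

theorem garble_apply (hd : d ≠ 0) (X : Op (Fin d)) :
    garble d X = ((d : ℂ) ^ 2 - 1)⁻¹ • (((d : ℂ) * X.trace) • (1 : Op (Fin d)) - X) := by
  have : NeZero d := ⟨hd⟩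
  rw [garble, LinearMap.smul_apply, LinearMap.sum_apply, ← sum_conjMap_pauli hd X]
  congr 1
  rw [eq_sub_iff_add_eq, ← Finset.sum_filter_add_sum_filter_not Finset.univ
    (fun p : Fin d × Fin d => ¬ ((p.1 : ℕ) = 0 ∧ (p.2 : ℕ) = 0))]
  congr 1
  have : (Finset.univ : Finset (Fin d × Fin d)).filter
      (fun p => ¬ ¬ ((p.1 : ℕ) = 0 ∧ (p.2 : ℕ) = 0)) = {(0, 0)} := by
    ext p
    simp only [not_not, Finset.mem_filter, Finset.mem_univ, true_and, Finset.mem_singleton,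
      Prod.ext_iff, Fin.ext_iff, Fin.val_zero]
  rw [this, Finset.sum_singleton]
  have hX : pauliX d (0 : Fin d) = 1 := by
    ext i k
    simp [pauliX, Matrix.one_apply, Nat.mod_eq_of_lt, Fin.ext_iff]
  have hZ : pauliZ d (0 : Fin d) = 1 := by
    simp [pauliZ]
  rw [hX, hZ, Matrix.one_mul, conjMap_one, LinearMap.id_apply]

theorem garble_eq (hd : d ≠ 0) :
    garble d = ((d : ℂ) ^ 2 - 1)⁻¹ • ((d : ℂ) • traceOut (Fin d) - LinearMap.id) := by
  ext1 X
  rw [garble_apply hd]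
  simp [traceOut_apply, smul_smul]

theorem isCP_garble (hd : d ≠ 0) : IsCP (garble d) := by
  have h : ((d : ℂ) ^ 2 - 1)⁻¹ = ((((d : ℝ) ^ 2 - 1)⁻¹ : ℝ) : ℂ) := by push_cast; rfl
  rw [garble, h]
  refine (isCP_sum _ fun p => isCP_conjMap _).smul ?_
  have : (1 : ℝ) ≤ d := by exact_mod_cast Nat.one_le_iff_ne_zero.2 hd
  exact inv_nonneg.2 (by nlinarith)

theorem sq_sub_one_ne_zero (hd : 2 ≤ d) : (d : ℂ) ^ 2 - 1 ≠ 0 := by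
  have : (2 : ℝ) ≤ d := by exact_mod_cast hd
  have h : (d : ℝ) ^ 2 - 1 ≠ 0 := by nlinarith
  exact_mod_cast h

theorem isChannel_garble (hd : 2 ≤ d) : IsChannel (garble d) := by
  refine ⟨isCP_garble (by omega), fun X => ?_⟩
  rw [garble_apply (by omega), Matrix.trace_smul, Matrix.trace_sub, Matrix.trace_smul,
    Matrix.trace_one, Fintype.card_fin]
  have := sq_sub_one_ne_zero hd
  simp only [smul_eq_mul]
  field_simp

end Garble

/-! ### Trace norm and fidelity estimates -/

section TraceNorm

variable {a b c : Type} [Fintype a] [DecidableEq a] [Fintype b] [DecidableEq b]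
  [Fintype c] [DecidableEq c]

theorem trace_mul_nonneg {P Q : Op a} (hP : P.PosSemidef) (hQ : Q.PosSemidef) :
    0 ≤ (P * Q).trace := by
  obtain ⟨B, rfl⟩ := CStarAlgebra.nonneg_iff_eq_star_mul_self.mp hQ.nonneg
  rw [← Matrix.mul_assoc, Matrix.trace_mul_comm, ← Matrix.mul_assoc]
  exact (hP.mul_mul_conjTranspose_same B).trace_nonneg

theorem re_trace_mul_nonneg {P Q : Op a} (hP : P.PosSemidef) (hQ : Q.PosSemidef) :
    0 ≤ (P * Q).trace.re := (Complex.nonneg_iff.1 (trace_mul_nonneg hP hQ)).1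

theorem re_trace_mul_le {P Q R : Op a} (h : P ≤ Q) (hR : R.PosSemidef) :
    (P * R).trace.re ≤ (Q * R).trace.re := by
  have := re_trace_mul_nonneg (Matrix.le_iff.1 h) hR
  rw [Matrix.sub_mul, Matrix.trace_sub, Complex.sub_re] at this
  linarith

theorem re_trace_le {P Q : Op a} (h : P ≤ Q) : P.trace.re ≤ Q.trace.re := by
  simpa using re_trace_mul_le h (Matrix.PosSemidef.one (n := a) (R := ℂ))

theorem traceNorm_eq_abs (X : Op a) : traceNorm X = (CFC.abs X).trace.re := rfl

theorem traceNorm_of_isHermitian {H : Op a} (hH : H.IsHermitian) :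
    traceNorm H = (H⁺).trace.re + (H⁻).trace.re := by
  have h : IsSelfAdjoint H := hH
  rw [traceNorm_eq_abs, ← CFC.posPart_add_negPart H h, Matrix.trace_add, Complex.add_re]

/-- Split `H` into positive and negative parts and use `U ≤ 1` on the first and `-1 ≤ U` on the
second. -/
theorem re_trace_mul_le_traceNorm {H U : Op a} (hH : H.IsHermitian) (hU : U ≤ 1) (hU' : -1 ≤ U) :
    (U * H).trace.re ≤ traceNorm H := by
  have h : IsSelfAdjoint H := hH
  rw [traceNorm_of_isHermitian hH]
  have h1 := re_trace_mul_le hU (Matrix.nonneg_iff_posSemidef.1 (CFC.posPart_nonneg H))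
  have h2 := re_trace_mul_le hU' (Matrix.nonneg_iff_posSemidef.1 (CFC.negPart_nonneg H))
  have h3 : (U * H).trace.re = (U * H⁺).trace.re - (U * H⁻).trace.re := by
    conv_lhs => rw [← CFC.posPart_sub_negPart H h]
    rw [Matrix.mul_sub, Matrix.trace_sub, Complex.sub_re]
  simp only [one_mul, neg_mul, Matrix.trace_neg, Complex.neg_re] at h1 h2
  linarith

theorem traceNorm_sub_le {P Q : Op a} (hP : P.PosSemidef) (hQ : Q.PosSemidef) :
    traceNorm (P - Q) ≤ P.trace.re + Q.trace.re := by
  have hH : (P - Q).IsHermitian := hP.1.sub hQ.1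
  have h : IsSelfAdjoint (P - Q) := hH
  set H := P - Q with hHdef
  -- The sign function attains the trace norm: `|H| = s(H) H` with `-1 ≤ s(H) ≤ 1`. Continuity on
  -- the spectrum is automatic because the spectrum is finite.
  let s : ℝ → ℝ := fun x => if 0 ≤ x then 1 else -1
  have hs : ContinuousOn s (spectrum ℝ H) := (Set.toFinite _).continuousOn _
  have habs : CFC.abs H = cfc s H * H := by
    rw [CFC.abs_eq_cfc_norm H h]
    conv_rhs => rw [← cfc_id' ℝ H h]
    rw [cfc_id' ℝ H h]
    conv_rhs => enter [2]; rw [← cfc_id ℝ H h]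
    rw [← cfc_mul s id H hs continuousOn_id]
    refine cfc_congr fun x _ => ?_
    simp only [s, id, Real.norm_eq_abs]
    split_ifs with hx
    · rw [abs_of_nonneg hx, one_mul]
    · rw [abs_of_neg (not_le.1 hx), neg_one_mul]
  have hU : cfc s H ≤ 1 := cfc_le_one s H fun x _ => by simp only [s]; split_ifs <;> norm_num
  have hU' : -1 ≤ cfc s H := by
    have := (algebraMap_le_cfc_iff s (-1) H hs h).2 fun x _ => by
      simp only [s]; split_ifs <;> norm_num
    simpa using this
  rw [traceNorm_eq_abs, habs]
  have h3 : (cfc s H * H).trace.re = (cfc s H * P).trace.re - (cfc s H * Q).trace.re := by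
    conv_lhs => rw [show cfc s H * H = cfc s H * P - cfc s H * Q by
      conv_lhs => enter [2]; rw [hHdef]
      rw [Matrix.mul_sub]]
    rw [Matrix.trace_sub, Complex.sub_re]
  have h1 := re_trace_mul_le hU hP
  have h2 := re_trace_mul_le hU' hQ
  simp only [one_mul, neg_mul, Matrix.trace_neg, Complex.neg_re] at h1 h2
  linarith

/-- Makes the trace of the square root a function of the characteristic polynomial, which `X† X` and
`X X†` share; this gives `traceNorm_conjTranspose`. -/
theorem trace_sqrt_eq {A : Op a} (hA : A.PosSemidef) :
    (CFC.sqrt A).trace = (A.charpoly.roots.map fun z => ((Real.sqrt z.re : ℝ) : ℂ)).sum := by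
  rw [hA.1.roots_charpoly_eq_eigenvalues, CFC.sqrt_eq_cfc, cfc_nnreal_eq_real _ A hA.nonneg,
    hA.1.cfc_eq, Matrix.IsHermitian.cfc, Unitary.conjStarAlgAut_apply, Matrix.trace_mul_cycle]
  simp [Matrix.trace, max_eq_left (hA.eigenvalues_nonneg _)]

theorem traceNorm_conjTranspose (X : Op a) : traceNorm Xᴴ = traceNorm X := by
  rw [traceNorm, traceNorm, trace_sqrt_eq (Matrix.posSemidef_conjTranspose_mul_self _),
    trace_sqrt_eq (Matrix.posSemidef_conjTranspose_mul_self _), Matrix.conjTranspose_conjTranspose,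
    Matrix.charpoly_mul_comm]

section
open scoped Matrix.Norms.L2Operator

/-- Operator monotonicity of the square root is a fact about C*-algebras, hence the operator norm
opened for this statement. -/
theorem sqrt_le_sqrt {P Q : Op a} (h : P ≤ Q) : CFC.sqrt P ≤ CFC.sqrt Q := CFC.sqrt_le_sqrt P Q h

end

theorem fidelity_nonneg (ω τ : Op a) : 0 ≤ fidelity ω τ := sq_nonneg _

/-- A state that dominates `k ω` has fidelity at least `k` with `ω`. -/
theorem le_fidelity {ω τ : Op a} (hω : IsState ω) (hτ : τ.PosSemidef) {k : ℝ} (hk : 0 ≤ k)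
    (h : (k : ℂ) • ω ≤ τ) : k ≤ fidelity ω τ := by
  have hsω : (CFC.sqrt ω)ᴴ = CFC.sqrt ω := (Matrix.nonneg_iff_posSemidef.1 (CFC.sqrt_nonneg ω)).1
  have hsτ : (CFC.sqrt τ)ᴴ = CFC.sqrt τ := (Matrix.nonneg_iff_posSemidef.1 (CFC.sqrt_nonneg τ)).1
  -- Sandwiching `k ω ≤ τ` between `√ω` gives `(√k ω)² ≤ √ω τ √ω`. By monotonicity of the root the
  -- right side has root of trace at least `√k`, and that trace is the root fidelity.
  have h1 : ((Real.sqrt k : ℂ) • ω) * ((Real.sqrt k : ℂ) • ω)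
      ≤ CFC.sqrt ω * τ * CFC.sqrt ω := by
    have h2 := (Matrix.le_iff.1 h).mul_mul_conjTranspose_same (CFC.sqrt ω)
    rw [hsω, Matrix.mul_sub, Matrix.sub_mul] at h2
    refine (le_of_eq ?_).trans (Matrix.le_iff.2 h2)
    have h3 : ω = CFC.sqrt ω * CFC.sqrt ω := (CFC.sqrt_mul_sqrt_self ω hω.1.nonneg).symm
    rw [Matrix.smul_mul, Matrix.mul_smul, smul_smul, ← Complex.ofReal_mul, Real.mul_self_sqrt hk,
      Matrix.mul_smul, Matrix.smul_mul]
    congr 1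
    conv_lhs => rw [h3]
    conv_rhs => enter [1, 2]; rw [h3]
    simp only [Matrix.mul_assoc]
  have hkω : 0 ≤ (Real.sqrt k : ℂ) • ω :=
    (hω.1.smul (by exact_mod_cast Real.sqrt_nonneg k)).nonneg
  have h4 := re_trace_le (sqrt_le_sqrt h1)
  rw [CFC.sqrt_mul_self _ hkω] at h4
  have h5 : traceNorm (CFC.sqrt ω * CFC.sqrt τ)
      = (CFC.sqrt (CFC.sqrt ω * τ * CFC.sqrt ω)).trace.re := by
    rw [← traceNorm_conjTranspose, traceNorm, Matrix.conjTranspose_conjTranspose,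
      Matrix.conjTranspose_mul, hsω, hsτ]
    congr 3
    rw [Matrix.mul_assoc, ← Matrix.mul_assoc (CFC.sqrt τ), CFC.sqrt_mul_sqrt_self τ hτ.nonneg,
      Matrix.mul_assoc]
  rw [← h5, Matrix.trace_smul, hω.2, smul_eq_mul, mul_one, Complex.ofReal_re] at h4
  calc k = Real.sqrt k ^ 2 := (Real.sq_sqrt hk).symm
    _ ≤ _ := pow_le_pow_left₀ (Real.sqrt_nonneg k) h4 2

/-- The projection onto a vector. -/
def proj (v : a → ℂ) : Op a := Matrix.vecMulVec v (star v)

theorem proj_posSemidef (v : a → ℂ) : (proj v).PosSemidef := Matrix.posSemidef_vecMulVec_self_star v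

theorem trace_proj_mul (v : a → ℂ) (τ : Op a) : (proj v * τ).trace = star v ⬝ᵥ τ *ᵥ v := by
  rw [proj, Matrix.vecMulVec_mul, Matrix.trace_vecMulVec, dotProduct_comm,
    Matrix.dotProduct_mulVec]

theorem trace_proj (v : a → ℂ) : (proj v).trace = star v ⬝ᵥ v := by
  rw [proj, Matrix.trace_vecMulVec, dotProduct_comm]

theorem proj_mul_mul_proj (v : a → ℂ) (τ : Op a) :
    proj v * τ * proj v = (star v ⬝ᵥ τ *ᵥ v) • proj v := by
  rw [proj, Matrix.vecMulVec_mul, Matrix.vecMulVec_mul_vecMulVec, Matrix.dotProduct_mulVec,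
    Matrix.vecMulVec_smul]

theorem proj_mul_self {v : a → ℂ} (hv : star v ⬝ᵥ v = 1) : proj v * proj v = proj v := by
  have h := proj_mul_mul_proj v 1
  rwa [Matrix.mul_one, Matrix.one_mulVec, hv, one_smul] at h

theorem proj_le_one {v : a → ℂ} (hv : star v ⬝ᵥ v = 1) : proj v ≤ 1 := by
  rw [Matrix.le_iff]
  have h : 1 - proj v = (1 - proj v)ᴴ * (1 - proj v) := by
    rw [Matrix.conjTranspose_sub, Matrix.conjTranspose_one, (proj_posSemidef v).1.eq,
      Matrix.mul_sub, Matrix.sub_mul, Matrix.sub_mul, proj_mul_self hv]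
    simp
  rw [h]
  exact Matrix.posSemidef_conjTranspose_mul_self _

theorem re_expectation_eq {τ : Op a} (hτ : τ.PosSemidef) (v : a → ℂ) :
    (((star v ⬝ᵥ τ *ᵥ v).re : ℝ) : ℂ) = star v ⬝ᵥ τ *ᵥ v :=
  Complex.ext rfl (Complex.nonneg_iff.1 (hτ.dotProduct_mulVec_nonneg v)).2

/-- The fidelity with a pure state is the overlap. -/
theorem fidelity_proj {v : a → ℂ} (hv : star v ⬝ᵥ v = 1) {τ : Op a} (hτ : τ.PosSemidef) :
    fidelity (proj v) τ = (star v ⬝ᵥ τ *ᵥ v).re := by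
  have hP := proj_posSemidef v
  have hsτ : (CFC.sqrt τ)ᴴ = CFC.sqrt τ := (Matrix.nonneg_iff_posSemidef.1 (CFC.sqrt_nonneg τ)).1
  have hsP : CFC.sqrt (proj v) = proj v := by
    conv_lhs => rw [← proj_mul_self hv]
    exact CFC.sqrt_mul_self _ hP.nonneg
  have ht : 0 ≤ (star v ⬝ᵥ τ *ᵥ v).re := hτ.re_dotProduct_nonneg v
  set t := (star v ⬝ᵥ τ *ᵥ v).re
  have h1 : proj v * τ * proj v = ((Real.sqrt t : ℂ) • proj v) * ((Real.sqrt t : ℂ) • proj v) := by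
    rw [proj_mul_mul_proj, Matrix.smul_mul, Matrix.mul_smul, smul_smul, ← Complex.ofReal_mul,
      Real.mul_self_sqrt ht, proj_mul_self hv, re_expectation_eq hτ]
  have h2 : 0 ≤ (Real.sqrt t : ℂ) • proj v :=
    (hP.smul (by exact_mod_cast Real.sqrt_nonneg t)).nonneg
  rw [fidelity, hsP, ← traceNorm_conjTranspose, traceNorm, Matrix.conjTranspose_conjTranspose,
    Matrix.conjTranspose_mul, hsτ, hP.1.eq, Matrix.mul_assoc, ← Matrix.mul_assoc (CFC.sqrt τ),
    CFC.sqrt_mul_sqrt_self τ hτ.nonneg, ← Matrix.mul_assoc, h1, CFC.sqrt_mul_self _ h2,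
    Matrix.trace_smul, trace_proj, hv, smul_eq_mul, mul_one, Complex.ofReal_re, Real.sq_sqrt ht]

/-- The trace distance to a pure state is bounded below by the infidelity. -/
theorem le_traceNorm_proj_sub {v : a → ℂ} (hv : star v ⬝ᵥ v = 1) {τ : Op a} (hτ : IsState τ) :
    1 - (star v ⬝ᵥ τ *ᵥ v).re ≤ 1 / 2 * traceNorm (proj v - τ) := by
  have hP := proj_posSemidef v
  -- The test operator is the reflection `2P - 1`, whose pairing with `P - τ` is twice the
  -- infidelity.
  have h1 : proj v + proj v - 1 ≤ 1 := by
    rw [Matrix.le_iff]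
    have h := Matrix.le_iff.1 (proj_le_one hv)
    convert h.add h using 1
    abel
  have h2 : -1 ≤ proj v + proj v - 1 := by
    rw [Matrix.le_iff]
    rw [sub_neg_eq_add, sub_add_cancel]
    exact hP.add hP
  have h3 := re_trace_mul_le_traceNorm (hP.1.sub hτ.1.1) h1 h2
  rw [Matrix.sub_mul, Matrix.add_mul, Matrix.mul_sub, proj_mul_self hv, one_mul,
    Matrix.trace_sub, Matrix.trace_add, Matrix.trace_sub, trace_proj_mul, Matrix.trace_sub,
    trace_proj, hv, hτ.2] at h3
  simp at h3
  linarith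

end TraceNorm

/-! ### Entanglement fidelity and the weights of a twirled superoperator -/

section EntanglementFidelity

variable {a b c : Type} [Fintype a] [DecidableEq a] [Fintype b] [DecidableEq b]
  [Fintype c] [DecidableEq c]

/-- The entanglement fidelity of a linear map: the overlap of its Choi state with the maximally
entangled state. -/
def entFid : (Op c →ₗ[ℂ] Op c) →ₗ[ℂ] ℂ :=
  ((Fintype.card c : ℂ) ^ 2)⁻¹ • LinearMap.trace ℂ (Op c)

theorem entFid_apply (H : Op c →ₗ[ℂ] Op c) :
    entFid H = ((Fintype.card c : ℂ) ^ 2)⁻¹ * LinearMap.trace ℂ (Op c) H := rfl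

theorem trace_superop_eq_sum (H : Op c →ₗ[ℂ] Op c) :
    LinearMap.trace ℂ (Op c) H = ∑ k, ∑ l, H (Matrix.single k l 1) k l := by
  rw [LinearMap.trace_eq_matrix_trace ℂ (Matrix.stdBasis ℂ c c), Matrix.trace,
    Fintype.sum_prod_type]
  refine Finset.sum_congr rfl fun k _ => Finset.sum_congr rfl fun l _ => ?_
  rw [Matrix.diag_apply, LinearMap.toMatrix_apply, Matrix.stdBasis_eq_single]
  rfl

theorem trace_conjMap_superop (K : Op c) :
    LinearMap.trace ℂ (Op c) (conjMap K) = K.trace * star K.trace := by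
  rw [trace_superop_eq_sum]
  simp only [conjMap_single, ← Finset.mul_sum, ← Finset.sum_mul, Matrix.trace, star_sum,
    Matrix.diag_apply]

/-- Each Kraus operator `K` contributes `|Tr K|² / d²`, with `d` the dimension of the system. -/
theorem entFid_nonneg {H : Op c →ₗ[ℂ] Op c} (hH : IsCP H) : 0 ≤ entFid H := by
  obtain ⟨ι, _, K, rfl⟩ := (isCP_iff_exists_kraus _).1 hH
  rw [map_sum]
  refine Finset.sum_nonneg fun t _ => ?_
  rw [entFid_apply, trace_conjMap_superop]
  refine mul_nonneg ?_ (mul_star_self_nonneg _)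
  simp

theorem entFid_tensorMap (E : Op a →ₗ[ℂ] Op a) (F : Op b →ₗ[ℂ] Op b) :
    entFid (tensorMap E F) = entFid E * entFid F := by
  simp only [entFid_apply, trace_superop_eq_sum, Fintype.sum_prod_type, single_eq_kronecker,
    tensorMap_kronecker, Matrix.kronecker_apply, ← Finset.mul_sum, ← Finset.sum_mul,
    Fintype.card_prod]
  push_cast
  rw [mul_pow, mul_inv]
  ring

theorem trace_adAct {U : Op c} (hU : Uᴴ * U = 1) (E : Op c →ₗ[ℂ] Op c) :
    LinearMap.trace ℂ (Op c) (adAct U E) = LinearMap.trace ℂ (Op c) E := by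
  rw [adAct_apply, LinearMap.trace_comp_comm', LinearMap.comp_assoc, conjMap_comp, hU,
    conjMap_one, LinearMap.comp_id]

theorem traceOut_comp_conjMap {U : Op c} (hU : Uᴴ * U = 1) :
    traceOut c ∘ₗ conjMap U = traceOut c := by
  ext1 X
  simp only [LinearMap.comp_apply, traceOut_apply, trace_conjMap hU]

/-- `traceOut` absorbs unitary conjugation on either side. Together with `trace_adAct` this provides
two twirl-invariant functionals, enough to fix the two coefficients of a twirled map. -/
theorem trace_traceOut_comp_adAct {U : Op c} (hU : Uᴴ * U = 1) (E : Op c →ₗ[ℂ] Op c) :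
    LinearMap.trace ℂ (Op c) (traceOut c ∘ₗ adAct U E)
      = LinearMap.trace ℂ (Op c) (traceOut c ∘ₗ E) := by
  have hU' : Uᴴᴴ * Uᴴ = 1 := by
    rw [Matrix.conjTranspose_conjTranspose]; exact mul_eq_one_comm.1 hU
  have h : conjMap Uᴴ ∘ₗ traceOut c = traceOut c := by
    ext1 X
    simp only [LinearMap.comp_apply, traceOut_apply, map_smul]
    rw [conjMap_apply, Matrix.mul_one, Matrix.conjTranspose_conjTranspose, hU]
  rw [adAct_apply, ← LinearMap.comp_assoc, traceOut_comp_conjMap hU, ← LinearMap.comp_assoc,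
    LinearMap.trace_comp_comm', ← LinearMap.comp_assoc, h]

theorem IsUnitaryMixture.trace_twirl {ι : Type} [Fintype ι] {p : ι → ℝ} {U : ι → Op c}
    (h : IsUnitaryMixture p U) (E : Op c →ₗ[ℂ] Op c) :
    LinearMap.trace ℂ (Op c) (twirl p U E) = LinearMap.trace ℂ (Op c) E := by
  rw [twirl_apply, map_sum]
  simp only [map_smul, trace_adAct (h.unitary _), ← Finset.sum_smul, ← Complex.ofReal_sum,
    h.sum_eq_one, Complex.ofReal_one, one_smul]

theorem IsUnitaryMixture.trace_traceOut_comp_twirl {ι : Type} [Fintype ι] {p : ι → ℝ}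
    {U : ι → Op c} (h : IsUnitaryMixture p U) (E : Op c →ₗ[ℂ] Op c) :
    LinearMap.trace ℂ (Op c) (traceOut c ∘ₗ twirl p U E)
      = LinearMap.trace ℂ (Op c) (traceOut c ∘ₗ E) := by
  have h1 : traceOut c ∘ₗ twirl p U E = ∑ i, (p i : ℂ) • (traceOut c ∘ₗ adAct (U i) E) := by
    ext1 X
    simp only [twirl_apply, LinearMap.comp_apply, LinearMap.sum_apply, LinearMap.smul_apply,
      map_sum, map_smul]
  rw [h1, map_sum]
  simp only [map_smul, trace_traceOut_comp_adAct (h.unitary _), ← Finset.sum_smul,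
    ← Complex.ofReal_sum, h.sum_eq_one, Complex.ofReal_one, one_smul]

theorem trace_superop_id :
    LinearMap.trace ℂ (Op c) LinearMap.id = (Fintype.card c : ℂ) ^ 2 := by
  rw [← conjMap_one, trace_conjMap_superop, Matrix.trace_one]
  simp [sq]

theorem trace_superop_traceOut : LinearMap.trace ℂ (Op c) (traceOut c) = Fintype.card c := by
  rw [trace_superop_eq_sum]
  simp only [traceOut_entry]
  simp

theorem traceOut_comp_traceOut :
    traceOut c ∘ₗ traceOut c = (Fintype.card c : ℂ) • traceOut c := by
  ext1 X
  simp only [LinearMap.comp_apply, traceOut_apply, Matrix.trace_smul, Matrix.trace_one,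
    LinearMap.smul_apply, smul_smul, smul_eq_mul, mul_comm]

/-- Twirling a superoperator leaves a combination of the identity and the garbling channel, with
weights given by entanglement fidelities. -/
theorem exists_twirl_eq_garble {d : ℕ} (hd : 2 ≤ d) :
    ∃ (n : ℕ) (p : Fin n → ℝ) (U : Fin n → Op (Fin d)), IsUnitaryMixture p U ∧
      ∀ E, twirl p U E = entFid E • LinearMap.id
        + (((d : ℂ) ^ 2 - 1) * entFid (garble d ∘ₗ E)) • garble d := by
  obtain ⟨n, p, U, hpU, h⟩ := exists_twirl_eq hd
  refine ⟨n, p, U, hpU, fun E => ?_⟩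
  obtain ⟨x, y, hE⟩ := h E
  have h0 : d ≠ 0 := by omega
  have hd0 : (d : ℂ) ≠ 0 := Nat.cast_ne_zero.2 h0
  have hd1 := sq_sub_one_ne_zero hd
  -- The invariants read `x d² + y d` and `x d + y d²`. Rewriting `traceOut` as `(id + (d² - 1)
  -- garble) / d` gives the weights `x + y/d` and `(d² - 1) y/d`, which `e1` and `e2` identify with
  -- the claimed ones.
  have h1 := hpU.trace_twirl E
  have h2 := hpU.trace_traceOut_comp_twirl E
  rw [hE] at h1 h2
  simp only [LinearMap.comp_add, LinearMap.comp_smul, LinearMap.comp_id, traceOut_comp_traceOut,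
    map_add, map_smul, trace_superop_id, trace_superop_traceOut, smul_eq_mul,
    Fintype.card_fin] at h1 h2
  have h3 : garble d ∘ₗ E = ((d : ℂ) ^ 2 - 1)⁻¹ • ((d : ℂ) • (traceOut (Fin d) ∘ₗ E) - E) := by
    rw [garble_eq h0, LinearMap.smul_comp, LinearMap.sub_comp, LinearMap.smul_comp,
      LinearMap.id_comp]
  rw [hE, h3]
  simp only [entFid_apply, map_smul, map_sub, ← h1, ← h2, smul_eq_mul, Fintype.card_fin]
  rw [garble_eq h0]
  have e1 : ((d : ℂ) ^ 2)⁻¹ * (x * d ^ 2 + y * d) = x + y * (d : ℂ)⁻¹ := by field_simp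
  have e2 : ((d : ℂ) ^ 2 - 1) * (((d : ℂ) ^ 2 - 1)⁻¹
      * (d * (((d : ℂ) ^ 2)⁻¹ * (x * d + y * (d * d))) - (x + y * (d : ℂ)⁻¹)))
      = y * (d : ℂ)⁻¹ * ((d : ℂ) ^ 2 - 1) := by field_simp; ring
  rw [e1, e2, smul_smul, mul_assoc, mul_inv_cancel₀ hd1, mul_one, smul_sub, smul_smul, mul_assoc,
    inv_mul_cancel₀ hd0, mul_one]
  module

end EntanglementFidelity

/-! ### Bounds on diamond distance and channel fidelity -/

section LowerBound

variable {c : Type} [Fintype c] [DecidableEq c]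

/-- The maximally entangled vector of the system `c` and a reference system. -/
def maxEntVec (c : Type) [Fintype c] [DecidableEq c] : Fin (Fintype.card c) × c → ℂ :=
  fun p => if p.1 = Fintype.equivFin c p.2 then (((Real.sqrt (Fintype.card c))⁻¹ : ℝ) : ℂ) else 0

theorem sum_maxEntVec_mul (f : Fin (Fintype.card c) × c → ℂ) :
    ∑ p, maxEntVec c p * f p
      = ∑ k, (((Real.sqrt (Fintype.card c))⁻¹ : ℝ) : ℂ) * f (Fintype.equivFin c k, k) := by
  rw [Fintype.sum_prod_type, Finset.sum_comm]
  refine Finset.sum_congr rfl fun k _ => ?_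
  rw [Finset.sum_eq_single (Fintype.equivFin c k)]
  · simp [maxEntVec]
  · intro i _ hi; simp [maxEntVec, hi]
  · simp

theorem star_maxEntVec : star (maxEntVec c) = maxEntVec c := by
  ext p
  simp only [Pi.star_apply, maxEntVec]
  split_ifs <;> simp

theorem maxEntVec_norm [Nonempty c] : star (maxEntVec c) ⬝ᵥ maxEntVec c = 1 := by
  rw [star_maxEntVec, dotProduct, sum_maxEntVec_mul]
  simp only [maxEntVec, if_true, sqrt_inv_mul_self, Finset.sum_const, Finset.card_univ,
    nsmul_eq_mul]
  exact mul_inv_cancel₀ (Nat.cast_ne_zero.2 Fintype.card_ne_zero)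

theorem isState_proj {v : c → ℂ} (hv : star v ⬝ᵥ v = 1) : IsState (proj v) :=
  ⟨proj_posSemidef v, by rw [trace_proj, hv]⟩

theorem proj_maxEntVec : proj (maxEntVec c) = (Fintype.card c : ℂ)⁻¹ • ∑ k, ∑ l,
    Matrix.single (Fintype.equivFin c k) (Fintype.equivFin c l) (1 : ℂ)
      ⊗ₖ Matrix.single k l (1 : ℂ) := by
  ext ⟨p, q⟩ ⟨p', q'⟩
  simp only [proj, Matrix.vecMulVec_apply, star_maxEntVec, Matrix.smul_apply, Matrix.sum_apply,
    Matrix.kronecker_apply, Matrix.single_apply, ← sqrt_inv_mul_self, maxEntVec]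
  rw [Finset.sum_eq_single q, Finset.sum_eq_single q']
  · by_cases h1 : p = Fintype.equivFin c q <;> by_cases h2 : p' = Fintype.equivFin c q' <;>
      simp [h1, h2, eq_comm]
  all_goals simp +contextual

theorem expectation_maxEntVec (H : Op c →ₗ[ℂ] Op c) :
    star (maxEntVec c) ⬝ᵥ tensorMap LinearMap.id H (proj (maxEntVec c)) *ᵥ maxEntVec c
      = entFid H := by
  rw [proj_maxEntVec, map_smul, Matrix.smul_mulVec, dotProduct_smul, star_maxEntVec, dotProduct,
    sum_maxEntVec_mul]
  simp only [Matrix.mulVec, dotProduct, mul_comm _ (maxEntVec c _), sum_maxEntVec_mul]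
  simp only [map_sum, tensorMap_kronecker, LinearMap.id_apply, Matrix.sum_apply,
    Matrix.kronecker_apply, Matrix.single_apply, EmbeddingLike.apply_eq_iff_eq]
  have h : ∀ k l : c, (∑ x, ∑ x_1, (if x = k ∧ x_1 = l then (1 : ℂ) else 0)
      * H (Matrix.single x x_1 1) k l) = H (Matrix.single k l 1) k l := fun k l => by
    rw [Finset.sum_eq_single k, Finset.sum_eq_single l] <;> simp +contextual
  simp only [h, ← Finset.mul_sum]
  rw [← mul_assoc, sqrt_inv_mul_self, smul_eq_mul, entFid_apply, trace_superop_eq_sum, sq, mul_inv,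
    mul_assoc]

theorem conjMap_proj {a : Type} [Fintype a] [DecidableEq a] (K : Matrix c a ℂ) (v : a → ℂ) :
    conjMap K (proj v) = proj (K *ᵥ v) := by
  rw [conjMap_apply, proj, proj, Matrix.mul_vecMulVec, Matrix.vecMulVec_mul, Matrix.star_mulVec]

theorem one_kronecker_unitary {r : ℕ} {U : Op c} (hU : Uᴴ * U = 1) :
    ((1 : Op (Fin r)) ⊗ₖ U)ᴴ * ((1 : Op (Fin r)) ⊗ₖ U) = 1 := by
  rw [Matrix.conjTranspose_kronecker, ← Matrix.mul_kronecker_mul, hU]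
  simp

/-- The image of the maximally entangled vector under a unitary. -/
def choiVec (U : Op c) : Fin (Fintype.card c) × c → ℂ := ((1 : Op (Fin _)) ⊗ₖ U) *ᵥ maxEntVec c

theorem choiVec_norm [Nonempty c] {U : Op c} (hU : Uᴴ * U = 1) :
    star (choiVec U) ⬝ᵥ choiVec U = 1 := by
  rw [choiVec, Matrix.star_mulVec, ← Matrix.dotProduct_mulVec, Matrix.mulVec_mulVec,
    one_kronecker_unitary hU, Matrix.one_mulVec, maxEntVec_norm]

theorem tensorMap_conjMap_maxEnt (U : Op c) :
    tensorMap LinearMap.id (conjMap U) (proj (maxEntVec c)) = proj (choiVec U) := by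
  rw [← conjMap_one, tensorMap_conjMap, conjMap_proj]; rfl

/-- Moving `U` from the vector onto the map turns the overlap with a rotated maximally entangled
state into an entanglement fidelity. -/
theorem expectation_choiVec (U : Op c) (N : Op c →ₗ[ℂ] Op c) :
    star (choiVec U) ⬝ᵥ tensorMap LinearMap.id N (proj (maxEntVec c)) *ᵥ choiVec U
      = entFid (conjMap Uᴴ ∘ₗ N) := by
  rw [← expectation_maxEntVec]
  have h := LinearMap.congr_fun (tensorMap_comp (LinearMap.id : Op (Fin (Fintype.card c)) →ₗ[ℂ] _)
    N LinearMap.id (conjMap Uᴴ)) (proj (maxEntVec c))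
  rw [LinearMap.comp_id, LinearMap.comp_apply] at h
  rw [← h]
  conv_rhs => rw [← conjMap_one, tensorMap_conjMap, conjMap_one, conjMap_apply]
  rw [choiVec, Matrix.star_mulVec, Matrix.conjTranspose_kronecker, Matrix.conjTranspose_one]
  simp only [Matrix.conjTranspose_kronecker, Matrix.conjTranspose_one,
    Matrix.conjTranspose_conjTranspose, Matrix.dotProduct_mulVec, Matrix.vecMul_vecMul,
    Matrix.mul_assoc]

theorem isState_tensorMap_id {r : ℕ} {a b : Type} [Fintype a] [DecidableEq a] [Fintype b]
    [DecidableEq b] {N : Op a →ₗ[ℂ] Op b} (hN : IsChannel N) {σ : Op (Fin r × a)}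
    (hσ : IsState σ) : IsState (tensorMap LinearMap.id N σ) :=
  (isChannel_id.tensorMap hN).isState hσ

/-- Needed because the supremum of an unbounded set of reals defaults to `0`, so a test state bounds
it from below only once boundedness is known. -/
theorem bddAbove_diamond {a b : Type} [Fintype a] [DecidableEq a] [Fintype b]
    [DecidableEq b] {N N' : Op a →ₗ[ℂ] Op b} (hN : IsChannel N) (hN' : IsChannel N') :
    BddAbove {x : ℝ | ∃ (r : ℕ) (ρ : Op (Fin r × a)), IsState ρ ∧
      x = traceNorm (tensorMap LinearMap.id N ρ - tensorMap LinearMap.id N' ρ)} := by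
  refine ⟨2, ?_⟩
  rintro x ⟨r, σ, hσ, rfl⟩
  have h := isState_tensorMap_id hN hσ
  have h' := isState_tensorMap_id hN' hσ
  have := traceNorm_sub_le h.1 h'.1
  rw [h.2, h'.2, Complex.one_re] at this
  linarith

/-- The diamond distance to a unitary channel is bounded below by the entanglement infidelity. -/
theorem le_half_diamondDist [Nonempty c] {U : Op c} (hU : Uᴴ * U = 1) {N : Op c →ₗ[ℂ] Op c}
    (hN : IsChannel N) :
    1 - (entFid (conjMap Uᴴ ∘ₗ N)).re ≤ 1 / 2 * diamondDist (conjMap U) N := by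
  have hσ := isState_proj (maxEntVec_norm (c := c))
  have h1 := le_traceNorm_proj_sub (choiVec_norm hU) (isState_tensorMap_id hN hσ)
  rw [expectation_choiVec, ← tensorMap_conjMap_maxEnt] at h1
  have h2 := le_csSup (bddAbove_diamond (isChannel_conjMap hU) hN) ⟨_, _, hσ, rfl⟩
  rw [diamondDist]
  linarith

theorem channelFidelity_le_entFid [Nonempty c] {U : Op c} (hU : Uᴴ * U = 1)
    {N : Op c →ₗ[ℂ] Op c} (hN : IsChannel N) :
    channelFidelity (conjMap U) N ≤ (entFid (conjMap Uᴴ ∘ₗ N)).re := by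
  have hσ := isState_proj (maxEntVec_norm (c := c))
  have h1 := fidelity_proj (choiVec_norm hU) (isState_tensorMap_id hN hσ).1
  rw [expectation_choiVec, ← tensorMap_conjMap_maxEnt] at h1
  rw [← h1]
  refine csInf_le ⟨0, ?_⟩ ⟨_, _, hσ, rfl⟩
  rintro x ⟨r, σ, _, rfl⟩
  exact fidelity_nonneg _ _

/-- A channel that dominates a multiple of another one is close to it in diamond distance. -/
theorem half_diamondDist_le [Nonempty c] {N N' R : Op c →ₗ[ℂ] Op c} (hN : IsChannel N)
    (hN' : IsChannel N') {k : ℝ} (hk : k ≤ 1) (hR : IsCP R) (h : N' = (k : ℂ) • N + R) :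
    1 / 2 * diamondDist N N' ≤ 1 - k := by
  have h2 : diamondDist N N' ≤ 2 * (1 - k) := by
    refine csSup_le ⟨_, _, _, isState_proj (maxEntVec_norm (c := c)), rfl⟩ ?_
    rintro x ⟨r, σ, hσ, rfl⟩
    have h1 := isState_tensorMap_id hN hσ
    have h1' := isState_tensorMap_id hN' hσ
    have hR' := (isCP_id.tensorMap hR).posSemidef hσ.1 (X := σ)
    have h3 : tensorMap LinearMap.id N' σ = (k : ℂ) • tensorMap LinearMap.id N σ
        + tensorMap LinearMap.id R σ := by
      rw [h, tensorMap_add_right, tensorMap_smul_right]; rfl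
    have htr := congrArg (fun X => (Matrix.trace X).re) h3
    simp only [h1'.2, Matrix.trace_add, Matrix.trace_smul, h1.2, Complex.add_re, smul_eq_mul,
      mul_one, Complex.ofReal_re, Complex.one_re] at htr
    -- Cancelling the common part `k N` leaves a difference of two positive operators of trace `1 -
    -- k` each.
    have h4 : tensorMap LinearMap.id N σ - tensorMap LinearMap.id N' σ
        = ((1 - k : ℝ) : ℂ) • tensorMap LinearMap.id N σ - tensorMap LinearMap.id R σ := by
      rw [h3]; push_cast; module
    rw [h4]
    refine (traceNorm_sub_le (h1.1.smul (by exact_mod_cast sub_nonneg.2 hk)) hR').trans ?_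
    rw [Matrix.trace_smul, h1.2, smul_eq_mul, mul_one, Complex.ofReal_re]
    linarith
  linarith

/-- Domination passes to the outputs on every input state, where `le_fidelity` applies. -/
theorem le_channelFidelity [Nonempty c] {N N' R : Op c →ₗ[ℂ] Op c} (hN : IsChannel N)
    (hN' : IsChannel N') {k : ℝ} (hk : 0 ≤ k) (hR : IsCP R) (h : N' = (k : ℂ) • N + R) :
    k ≤ channelFidelity N N' := by
  refine le_csInf ⟨_, _, _, isState_proj (maxEntVec_norm (c := c)), rfl⟩ ?_
  rintro x ⟨r, σ, hσ, rfl⟩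
  refine le_fidelity (isState_tensorMap_id hN hσ) (isState_tensorMap_id hN' hσ).1 hk ?_
  rw [Matrix.le_iff, h, tensorMap_add_right, tensorMap_smul_right, LinearMap.add_apply,
    LinearMap.smul_apply, add_sub_cancel_left]
  exact (isCP_id.tensorMap hR).posSemidef hσ.1

end LowerBound

/-! ### The swap channel and the appending of resource states -/

section SwapSimulation

variable {d : ℕ} {a b : Type} [Fintype a] [DecidableEq a] [Fintype b] [DecidableEq b]

theorem flipOp_eq : flipOp d = permOp (Equiv.prodComm (Fin d) (Fin d)) := by
  ext ⟨i, j⟩ ⟨k, l⟩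
  simp only [flipOp, permOp, Matrix.sum_apply, Matrix.kronecker_apply, Matrix.submatrix_apply,
    Matrix.one_apply, Matrix.single_apply, Equiv.prodComm_apply, Prod.swap_prod_mk, id,
    Prod.mk.injEq]
  rw [Finset.sum_eq_single i, Finset.sum_eq_single j]
  · by_cases h1 : j = k <;> by_cases h2 : i = l <;> simp [h1, h2]
  all_goals simp +contextual

theorem flipOp_unitary : (flipOp d)ᴴ * flipOp d = 1 := by
  rw [flipOp_eq, permOp_unitary]

theorem conjTranspose_flipOp : (flipOp d)ᴴ = flipOp d := by
  rw [flipOp_eq, conjTranspose_permOp]; rfl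

theorem isChannel_swapChannel : IsChannel (swapChannel d) := isChannel_conjMap flipOp_unitary

theorem swapChannel_kronecker (X Y : Op (Fin d)) : swapChannel d (X ⊗ₖ Y) = Y ⊗ₖ X := by
  rw [swapChannel, flipOp_eq, conjMap_permOp]
  ext ⟨i, j⟩ ⟨k, l⟩
  simp [mul_comm]

theorem swapChannel_comp_tensorMap (E F : Op (Fin d) →ₗ[ℂ] Op (Fin d)) :
    swapChannel d ∘ₗ tensorMap E F = tensorMap F E ∘ₗ swapChannel d :=
  op_prod_ext fun X Y => by simp [swapChannel_kronecker]

theorem swapChannel_comp_swapChannel : swapChannel d ∘ₗ swapChannel d = LinearMap.id :=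
  op_prod_ext fun X Y => by simp [swapChannel_kronecker]

theorem swapChannel_swapChannel (X : Op (Fin d × Fin d)) :
    swapChannel d (swapChannel d X) = X := LinearMap.congr_fun swapChannel_comp_swapChannel X

theorem appendState_apply (σ : Op (a × b)) (X : Op (Fin d × Fin d)) (i j k l : Fin d)
    (s s' : a) (t t' : b) :
    appendState σ X ((i, s), (j, t)) ((k, s'), (l, t')) = X (i, j) (k, l) * σ (s, t) (s', t') :=
  rfl

/-- `appendState` as a linear function of the appended operator. -/
def appendStateLin (d : ℕ) (a b : Type) [Fintype a] [DecidableEq a] [Fintype b] [DecidableEq b] :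
    Op (a × b) →ₗ[ℂ] Op (Fin d × Fin d) →ₗ[ℂ] Op ((Fin d × a) × (Fin d × b)) where
  toFun σ := appendState σ
  map_add' σ τ := by
    ext1 X; ext ⟨⟨i, s⟩, j, t⟩ ⟨⟨k, s'⟩, l, t'⟩
    simp only [LinearMap.add_apply, Matrix.add_apply, appendState_apply, mul_add]
  map_smul' r σ := by
    ext1 X; ext ⟨⟨i, s⟩, j, t⟩ ⟨⟨k, s'⟩, l, t'⟩
    simp only [LinearMap.smul_apply, Matrix.smul_apply, appendState_apply, RingHom.id_apply,
      smul_eq_mul]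
    ring

theorem appendStateLin_apply (σ : Op (a × b)) : appendStateLin d a b σ = appendState σ := rfl

theorem isCP_appendState {σ : Op (a × b)} (hσ : σ.PosSemidef) :
    IsCP (appendState (d := d) σ) := by
  obtain ⟨B, rfl⟩ := CStarAlgebra.nonneg_iff_eq_star_mul_self.mp hσ.nonneg
  refine (isCP_iff_exists_kraus _).2 ⟨a × b, inferInstance, fun t => Matrix.of fun p q =>
    if q = (p.1.1, p.2.1) then star (B t (p.1.2, p.2.2)) else 0, op_ext fun k l => ?_⟩
  ext ⟨⟨i, s⟩, j, u⟩ ⟨⟨i', s'⟩, j', u'⟩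
  rw [appendState_apply, LinearMap.sum_apply, Matrix.sum_apply]
  simp only [conjMap_single, Matrix.of_apply, Matrix.single_apply, Matrix.mul_apply,
    Matrix.star_apply, Finset.mul_sum]
  refine Finset.sum_congr rfl fun t _ => ?_
  by_cases h1 : k = (i, j) <;> by_cases h2 : l = (i', j') <;> simp [h1, h2]

theorem trace_appendState (σ : Op (a × b)) (X : Op (Fin d × Fin d)) :
    (appendState σ X).trace = X.trace * σ.trace := by
  rw [← Matrix.trace_kronecker]
  exact (Equiv.prodProdProdComm (Fin d) a (Fin d) b).sum_comp fun p => (X ⊗ₖ σ) p p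

theorem isChannel_appendState {σ : Op (a × b)} (hσ : IsState σ) :
    IsChannel (appendState (d := d) σ) :=
  ⟨isCP_appendState hσ.1, fun X => by rw [trace_appendState, hσ.2, mul_one]⟩

/-- Matrix units of the joint system are appended products. `σ` has to range over all operators
here, not only states. -/
theorem op_append_ext {V : Type*} [AddCommMonoid V] [Module ℂ V]
    {G H : Op ((Fin d × a) × (Fin d × b)) →ₗ[ℂ] V}
    (h : ∀ σ X, G (appendState σ X) = H (appendState σ X)) : G = H := by
  refine op_ext ?_
  rintro ⟨⟨i, s⟩, j, t⟩ ⟨⟨k, s'⟩, l, t'⟩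
  have : (Matrix.single ((i, s), (j, t)) ((k, s'), (l, t')) (1 : ℂ))
      = appendState (Matrix.single (s, t) (s', t') 1) (Matrix.single (i, j) (k, l) 1) := by
    ext ⟨⟨i1, s1⟩, j1, t1⟩ ⟨⟨k1, s1'⟩, l1, t1'⟩
    rw [appendState_apply]
    simp only [Matrix.single_apply, Prod.mk.injEq, ← ite_and, mul_ite, mul_one, mul_zero]
    congr 1
    simp only [eq_iff_iff]
    tauto
  rw [this, h]

theorem measureOut_appendState (K σ : Op (a × b)) (X : Op (Fin d × Fin d)) :
    measureOut K (appendState σ X) = (K * σ).trace • X := by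
  have h : ofParties (appendState σ X) = X ⊗ₖ σ := rfl
  ext i j
  change ∑ s, (((1 : Op (Fin d × Fin d)) ⊗ₖ K) * ofParties (appendState σ X)) (i, s) (j, s) = _
  rw [h, ← Matrix.mul_kronecker_mul, Matrix.one_mul]
  simp only [Matrix.kronecker_apply, ← Finset.mul_sum, Matrix.smul_apply, smul_eq_mul,
    Matrix.trace, Matrix.diag_apply, mul_comm]

theorem tensorMap_comp_appendState (E F : Op (Fin d) →ₗ[ℂ] Op (Fin d)) (σ : Op (a × b)) :
    tensorMap (tensorMap E (LinearMap.id : Op a →ₗ[ℂ] Op a))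
      (tensorMap F (LinearMap.id : Op b →ₗ[ℂ] Op b)) ∘ₗ appendState σ
      = appendState σ ∘ₗ tensorMap E F := by
  rw [← appendStateLin_apply]
  revert σ
  -- Both sides are linear in `σ` as well as in the input, so comparing them as maps of `σ` reduces
  -- the claim to product `σ` and product inputs.
  suffices h : LinearMap.llcomp ℂ _ _ _ (tensorMap (tensorMap E (LinearMap.id : Op a →ₗ[ℂ] Op a))
      (tensorMap F (LinearMap.id : Op b →ₗ[ℂ] Op b))) ∘ₗ appendStateLin d a b
      = (LinearMap.llcomp ℂ _ _ _).flip (tensorMap E F) ∘ₗ appendStateLin d a b from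
    fun σ => LinearMap.congr_fun h σ
  refine op_prod_ext fun σ τ => op_prod_ext fun X Y => ?_
  have key : ∀ X' Y' : Op (Fin d), appendState (σ ⊗ₖ τ) (X' ⊗ₖ Y') = (X' ⊗ₖ σ) ⊗ₖ (Y' ⊗ₖ τ) := by
    intro X' Y'
    ext ⟨⟨i, s⟩, j, t⟩ ⟨⟨k, s'⟩, l, t'⟩
    rw [appendState_apply]
    simp only [Matrix.kronecker_apply]
    ring
  change tensorMap _ _ (appendState (σ ⊗ₖ τ) (X ⊗ₖ Y))
    = appendState (σ ⊗ₖ τ) (tensorMap E F (X ⊗ₖ Y))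
  simp only [key, tensorMap_kronecker, LinearMap.id_apply]

end SwapSimulation

/-! ### Independent twirls on both systems and the four error weights -/

section DoubleTwirl

variable {d : ℕ}

/-- The identity or the garbling channel. -/
def garbleIf (d : ℕ) (t : Bool) : Op (Fin d) →ₗ[ℂ] Op (Fin d) :=
  if t then garble d else LinearMap.id

/-- The number of Pauli errors collected in `garbleIf`. -/
def garbleWeight (d : ℕ) (t : Bool) : ℝ := if t then (d : ℝ) ^ 2 - 1 else 1

theorem isChannel_garbleIf (hd : 2 ≤ d) (t : Bool) : IsChannel (garbleIf d t) := by
  cases t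
  · exact isChannel_id
  · exact isChannel_garble hd

theorem garbleWeight_nonneg (hd : 2 ≤ d) (t : Bool) : 0 ≤ garbleWeight d t := by
  have : (2 : ℝ) ≤ d := by exact_mod_cast hd
  cases t <;> simp only [garbleWeight] <;> norm_num
  linarith

/-- The weight of the errors `garbleIf s ⊗ garbleIf t` in a bipartite map. -/
def errorWeight (d : ℕ) (s t : Bool) :
    (Op (Fin d × Fin d) →ₗ[ℂ] Op (Fin d × Fin d)) →ₗ[ℂ] ℂ :=
  ((garbleWeight d s * garbleWeight d t : ℝ) : ℂ) • entFid ∘ₗ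
    LinearMap.llcomp ℂ _ _ _ (tensorMap (garbleIf d s) (garbleIf d t))

theorem errorWeight_apply (s t : Bool) (G : Op (Fin d × Fin d) →ₗ[ℂ] Op (Fin d × Fin d)) :
    errorWeight d s t G = ((garbleWeight d s * garbleWeight d t : ℝ) : ℂ)
      * entFid (tensorMap (garbleIf d s) (garbleIf d t) ∘ₗ G) := rfl

theorem errorWeight_nonneg (hd : 2 ≤ d) (s t : Bool)
    {G : Op (Fin d × Fin d) →ₗ[ℂ] Op (Fin d × Fin d)} (hG : IsCP G) :
    0 ≤ errorWeight d s t G :=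
  mul_nonneg (Complex.zero_le_real.2
    (mul_nonneg (garbleWeight_nonneg hd s) (garbleWeight_nonneg hd t)))
    (entFid_nonneg (((isChannel_garbleIf hd s).tensorMap (isChannel_garbleIf hd t)).1.comp hG))

theorem errorWeight_false_false (G : Op (Fin d × Fin d) →ₗ[ℂ] Op (Fin d × Fin d)) :
    errorWeight d false false G = entFid G := by
  simp [errorWeight_apply, garbleWeight, garbleIf]

/-- Independent twirls by the same distribution on both systems. -/
def doubleTwirl {n : ℕ} (p : Fin n → ℝ) (U : Fin n → Op (Fin d)) :
    (Op (Fin d × Fin d) →ₗ[ℂ] Op (Fin d × Fin d)) →ₗ[ℂ]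
      (Op (Fin d × Fin d) →ₗ[ℂ] Op (Fin d × Fin d)) :=
  ∑ x, ∑ y, ((p x : ℂ) * (p y : ℂ)) • adAct (U x ⊗ₖ U y)

theorem doubleTwirl_tensorMap {n : ℕ} (p : Fin n → ℝ) (U : Fin n → Op (Fin d))
    (E F : Op (Fin d) →ₗ[ℂ] Op (Fin d)) :
    doubleTwirl p U (tensorMap E F) = tensorMap (twirl p U E) (twirl p U F) := by
  simp only [doubleTwirl, twirl_apply, LinearMap.sum_apply, LinearMap.smul_apply,
    tensorMap_sum_left, tensorMap_sum_right, tensorMap_smul_left, tensorMap_smul_right,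
    Finset.smul_sum]
  rw [Finset.sum_comm]
  refine Finset.sum_congr rfl fun x _ => Finset.sum_congr rfl fun y _ => ?_
  rw [smul_smul]
  congr 1
  · ring
  · simp only [adAct_apply, ← tensorMap_comp, Matrix.conjTranspose_kronecker, tensorMap_conjMap]

/-- Both sides are linear in `G`, so it suffices to treat products. There the double twirl is a
product of twirls and the entanglement fidelity is multiplicative. -/
theorem doubleTwirl_eq {n : ℕ} {p : Fin n → ℝ} {U : Fin n → Op (Fin d)}
    (h : ∀ E, twirl p U E = entFid E • LinearMap.id
        + (((d : ℂ) ^ 2 - 1) * entFid (garble d ∘ₗ E)) • garble d)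
    (G : Op (Fin d × Fin d) →ₗ[ℂ] Op (Fin d × Fin d)) :
    doubleTwirl p U G
      = ∑ s, ∑ t, errorWeight d s t G • tensorMap (garbleIf d s) (garbleIf d t) := by
  have h' : ∀ E, twirl p U E
      = ∑ s, ((garbleWeight d s : ℂ) * entFid (garbleIf d s ∘ₗ E)) • garbleIf d s := fun E => by
    rw [h, Fintype.sum_bool, add_comm]
    simp [garbleWeight, garbleIf]
  have key : doubleTwirl p U = ∑ s, ∑ t, LinearMap.smulRight (errorWeight d s t)
      (tensorMap (garbleIf d s) (garbleIf d t)) := by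
    refine superop_ext fun E F => ?_
    simp only [doubleTwirl_tensorMap, h', LinearMap.sum_apply, LinearMap.smulRight_apply,
      tensorMap_sum_left, tensorMap_sum_right, tensorMap_smul_left, tensorMap_smul_right,
      errorWeight_apply, tensorMap_comp, entFid_tensorMap, Finset.smul_sum]
    rw [Finset.sum_comm]
    refine Finset.sum_congr rfl fun x _ => Finset.sum_congr rfl fun y _ => ?_
    rw [smul_smul]
    congr 1
    push_cast
    ring
  rw [key]
  simp only [LinearMap.sum_apply, LinearMap.smulRight_apply]

end DoubleTwirl

/-! ### Positive functionals as positive operators -/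

section Povm

variable {c : Type} [Fintype c] [DecidableEq c]

/-- The operator that represents a linear functional through the trace pairing. -/
def traceDual (κ : Op c →ₗ[ℂ] ℂ) : Op c := Matrix.of fun s t => κ (Matrix.single t s 1)

theorem trace_traceDual_mul (κ : Op c →ₗ[ℂ] ℂ) (σ : Op c) : (traceDual κ * σ).trace = κ σ := by
  conv_rhs => rw [op_eq_sum_single σ]
  simp only [map_sum, map_smul, smul_eq_mul, Matrix.trace, Matrix.diag_apply, Matrix.mul_apply,
    traceDual, Matrix.of_apply]
  rw [Finset.sum_comm]
  simp only [mul_comm]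

/-- Evaluating `κ` on rank-one projections gives the quadratic form of the operator. Over the
complex numbers its being real already forces hermiticity. -/
theorem posSemidef_traceDual {κ : Op c →ₗ[ℂ] ℂ} (hκ : ∀ σ : Op c, σ.PosSemidef → 0 ≤ κ σ) :
    (traceDual κ).PosSemidef := by
  have h : ∀ v : c → ℂ, 0 ≤ star v ⬝ᵥ traceDual κ *ᵥ v := fun v => by
    rw [← trace_proj_mul, Matrix.trace_mul_comm, trace_traceDual_mul]
    exact hκ _ (proj_posSemidef v)
  rw [← Matrix.isPositive_toEuclideanLin_iff, LinearMap.isPositive_iff_complex]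
  intro v
  have hv : inner ℂ (Matrix.toEuclideanLin (traceDual κ) v) v
      = star (star v.ofLp ⬝ᵥ traceDual κ *ᵥ v.ofLp) := by
    rw [EuclideanSpace.inner_eq_star_dotProduct, Matrix.ofLp_toLpLin, Matrix.toLin'_apply,
      Matrix.star_dotProduct]
    simp [dotProduct_comm]
  have h0 := Complex.nonneg_iff.1 (h v.ofLp)
  rw [hv]
  exact ⟨Complex.ext rfl (by simp [← h0.2]), by simpa using h0.1⟩

end Povm

/-! ### Symmetrization of LOCC simulations and the converse construction -/

section Main

variable {d : ℕ} {a b : Type} [Fintype a] [DecidableEq a] [Fintype b] [DecidableEq b]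

/-- Sampling a unitary is an instrument whose outcome is its label; the probability is absorbed into
the map. -/
theorem isInstrument_mixture {n : ℕ} {p : Fin n → ℝ} {U : Fin n → Op (Fin d)}
    (h : IsUnitaryMixture p U) :
    IsInstrument fun x =>
      tensorMap ((p x : ℂ) • conjMap (U x)ᴴ) (LinearMap.id : Op a →ₗ[ℂ] Op a) := by
  refine ⟨fun x => ((isCP_conjMap _).smul (h.nonneg x)).tensorMap isCP_id, fun X => ?_⟩
  rw [← Matrix.trace_sum, ← LinearMap.sum_apply, ← tensorMap_sum_left]
  refine trace_tensorMap (fun X => ?_) (fun _ => rfl) X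
  have h' : ∀ x, (conjMap (U x)ᴴ X).trace = X.trace := fun x => trace_conjMap
    (by rw [Matrix.conjTranspose_conjTranspose]; exact mul_eq_one_comm.1 (h.unitary x)) X
  simp only [LinearMap.sum_apply, Matrix.trace_sum, LinearMap.smul_apply, Matrix.trace_smul, h',
    ← Finset.sum_smul, ← Complex.ofReal_sum, h.sum_eq_one, Complex.ofReal_one, one_smul]

/-- Random local unitaries turn an LOCC simulation of the swap channel into a twirled one. -/
theorem IsLOCC.exists_doubleTwirl
    {L : Op ((Fin d × a) × (Fin d × b)) →ₗ[ℂ] Op (Fin d × Fin d)} (hL : IsLOCC L) {n : ℕ}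
    {p : Fin n → ℝ} {U : Fin n → Op (Fin d)} (h : IsUnitaryMixture p U) :
    ∃ L' : Op ((Fin d × a) × (Fin d × b)) →ₗ[ℂ] Op (Fin d × Fin d), IsLOCC L' ∧
      ∀ σ : Op (a × b), swapChannel d ∘ₗ simulation σ L'
        = doubleTwirl p U (swapChannel d ∘ₗ simulation σ L) := by
  refine ⟨_, hL.twirl (isInstrument_mixture (a := a) h) (isInstrument_mixture (a := b) h)
    (fun y => isChannel_conjMap (h.unitary y)) (fun x => isChannel_conjMap (h.unitary x)),
    fun σ => ?_⟩
  ext1 X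
  simp only [simulation, doubleTwirl, LinearMap.comp_apply, LinearMap.sum_apply, map_sum,
    LinearMap.smul_apply]
  refine Finset.sum_congr rfl fun x _ => Finset.sum_congr rfl fun y _ => ?_
  have h1 := LinearMap.congr_fun (tensorMap_comp_appendState ((p x : ℂ) • conjMap (U x)ᴴ)
    ((p y : ℂ) • conjMap (U y)ᴴ) σ) X
  have h2 : ∀ Y, _ := LinearMap.congr_fun (swapChannel_comp_tensorMap (conjMap (U y))
    (conjMap (U x)))
  simp only [LinearMap.comp_apply] at h1 h2
  rw [h1, h2, tensorMap_smul_left, tensorMap_smul_right, smul_smul, adAct_apply,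
    Matrix.conjTranspose_kronecker, ← tensorMap_conjMap, ← tensorMap_conjMap]
  simp only [LinearMap.smul_apply, map_smul, LinearMap.comp_apply]

/-- The weight of a pair of errors as a functional of the appended operator. -/
def errorFunctional (L : Op ((Fin d × a) × (Fin d × b)) →ₗ[ℂ] Op (Fin d × Fin d)) (s t : Bool) :
    Op (a × b) →ₗ[ℂ] ℂ :=
  errorWeight d s t ∘ₗ LinearMap.llcomp ℂ _ _ _ (swapChannel d ∘ₗ L) ∘ₗ appendStateLin d a b

theorem errorFunctional_apply (L : Op ((Fin d × a) × (Fin d × b)) →ₗ[ℂ] Op (Fin d × Fin d))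
    (s t : Bool) (σ : Op (a × b)) :
    errorFunctional L s t σ = errorWeight d s t (swapChannel d ∘ₗ simulation σ L) := rfl

/-- Every LOCC simulation can be symmetrized to a four-outcome channel of the same entanglement
fidelity. -/
theorem IsLOCC.entFid_mem_successValues (hd : 2 ≤ d)
    {L : Op ((Fin d × a) × (Fin d × b)) →ₗ[ℂ] Op (Fin d × Fin d)} (hL : IsLOCC L)
    (ρ : Op (a × b)) :
    (entFid (swapChannel d ∘ₗ simulation ρ L)).re ∈ successValues d ρ := by
  obtain ⟨n, p, U, hpU, htw⟩ := exists_twirl_eq_garble hd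
  obtain ⟨L', hL', hsim⟩ := hL.exists_doubleTwirl hpU
  let K : Bool → Bool → Op (a × b) := fun s t => traceDual (errorFunctional L s t)
  have hK : ∀ s t, (K s t).PosSemidef := fun s t => posSemidef_traceDual fun σ hσ => by
    rw [errorFunctional_apply]
    exact errorWeight_nonneg hd s t
      (isChannel_swapChannel.1.comp (hL.isChannel.1.comp (isCP_appendState hσ)))
  have hform : ∀ σ X, swapChannel d (L' (appendState σ X))
      = ∑ s, ∑ t, (K s t * σ).trace • tensorMap (garbleIf d s) (garbleIf d t) X := fun σ X => by
    have : swapChannel d (L' (appendState σ X)) = _ :=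
      LinearMap.congr_fun ((hsim σ).trans (doubleTwirl_eq htw _)) X
    simpa only [K, trace_traceDual_mul, errorFunctional_apply, LinearMap.sum_apply,
      LinearMap.smul_apply] using this
  have hsum : K false false + K false true + K true false + K true true = 1 := by
    -- Every map involved preserves the trace, so any input of trace one extracts the sum of the
    -- weights; a diagonal matrix unit is used.
    have hσ : ∀ σ : Op (a × b), ∑ s, ∑ t, (K s t * σ).trace = σ.trace := fun σ => by
      let i0 : Fin d × Fin d := (⟨0, by omega⟩, ⟨0, by omega⟩)
      have h := congrArg Matrix.trace (hform σ (Matrix.single i0 i0 1))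
      simpa [isChannel_swapChannel.2, hL'.isChannel.2, trace_appendState, Matrix.trace_sum,
        ((isChannel_garbleIf hd _).tensorMap (isChannel_garbleIf hd _)).2] using h.symm
    have h1 : K false false + K false true + K true false + K true true = ∑ s, ∑ t, K s t := by
      simp only [Fintype.sum_bool]; abel
    rw [h1]
    ext s t
    have h := hσ (Matrix.single t s 1)
    have htr : (Matrix.single t s (1 : ℂ)).trace = (1 : Op (a × b)) s t := by
      by_cases hst : t = s
      · subst hst; simp
      · rw [Matrix.trace_single_eq_of_ne _ _ _ hst, Matrix.one_apply_ne (Ne.symm hst)]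
    simp only [Matrix.trace_mul_single, MulOpposite.op_one, one_smul, htr] at h
    simpa only [Matrix.sum_apply] using h
  -- `hform` holds for all appended operators, so it determines `L'` itself. Being equal to `L'`,
  -- the four-outcome channel inherits the LOCC property.
  have hfour : fourOutcomeChannel d (K false false) (K false true) (K true false) (K true true)
      = L' := by
    refine op_append_ext fun σ X => ?_
    rw [← swapChannel_swapChannel (L' _), hform]
    simp only [fourOutcomeChannel, LinearMap.add_apply, LinearMap.comp_apply,
      measureOut_appendState, crossMap, map_smul, Fintype.sum_bool, map_add, garbleIf, if_true,
      Bool.false_eq_true, if_false, tensorMap_id, LinearMap.id_apply]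
    abel
  refine ⟨_, _, _, _, hK _ _, hK _ _, hK _ _, hK _ _, hsum, hfour ▸ hL', ?_⟩
  rw [Matrix.trace_mul_comm, trace_traceDual_mul, errorFunctional_apply, errorWeight_false_false]

theorem isCP_crossMap {E F : Op (Fin d) →ₗ[ℂ] Op (Fin d)} (hE : IsCP E) (hF : IsCP F) :
    IsCP (crossMap E F) := isChannel_swapChannel.1.comp (hE.tensorMap hF)

/-- The simulation by a four-outcome channel dominates a multiple of the swap channel. -/
theorem exists_simulation_eq (hd : 2 ≤ d) {ρ : Op (a × b)} (hρ : ρ.PosSemidef)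
    {K L M N : Op (a × b)} (hK : K.PosSemidef) (hL : L.PosSemidef) (hM : M.PosSemidef)
    (hN : N.PosSemidef) :
    ∃ R : Op (Fin d × Fin d) →ₗ[ℂ] Op (Fin d × Fin d), IsCP R ∧
      simulation ρ (fourOutcomeChannel d K L M N)
        = (((ρ * K).trace.re : ℝ) : ℂ) • swapChannel d + R := by
  have hre : ∀ {T : Op (a × b)}, T.PosSemidef → (T * ρ).trace = (((ρ * T).trace.re : ℝ) : ℂ) :=
    fun {T} hT => by
      rw [Matrix.trace_mul_comm]
      exact Complex.ext rfl (Complex.nonneg_iff.1 (trace_mul_nonneg hρ hT)).2.symm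
  have hg := (isChannel_garble hd).1
  refine ⟨(((ρ * L).trace.re : ℝ) : ℂ) • crossMap LinearMap.id (garble d)
    + (((ρ * M).trace.re : ℝ) : ℂ) • crossMap (garble d) LinearMap.id
    + (((ρ * N).trace.re : ℝ) : ℂ) • crossMap (garble d) (garble d),
    (((isCP_crossMap isCP_id hg).smul (re_trace_mul_nonneg hρ hL)).add
      ((isCP_crossMap hg isCP_id).smul (re_trace_mul_nonneg hρ hM))).add
      ((isCP_crossMap hg hg).smul (re_trace_mul_nonneg hρ hN)), ?_⟩
  ext1 X
  simp only [simulation, fourOutcomeChannel, LinearMap.comp_apply, LinearMap.add_apply,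
    measureOut_appendState, map_smul, LinearMap.smul_apply, hre hK, hre hL, hre hM, hre hN]
  abel

/-- Discarding the resource locally is enough. It makes the sets of errors nonempty and, through
symmetrization, the set of success values too. -/
theorem exists_isLOCC :
    ∃ L : Op ((Fin d × a) × (Fin d × b)) →ₗ[ℂ] Op (Fin d × Fin d), IsLOCC L :=
  ⟨_, .local_channels _ _ isChannel_discardSnd isChannel_discardSnd⟩

/-- Two-sided approximation determines an infimum through a supremum. -/
theorem csInf_eq_one_sub_csSup {S T : Set ℝ} (hS : S.Nonempty) (hT : BddAbove T)
    (hlow : ∀ x ∈ S, ∃ y ∈ T, 1 - y ≤ x) (hup : ∀ y ∈ T, ∃ x ∈ S, x ≤ 1 - y) :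
    sInf S = 1 - sSup T := by
  have hlb : ∀ x ∈ S, 1 - sSup T ≤ x := fun x hx => by
    obtain ⟨y, hy, hyx⟩ := hlow x hx
    have := le_csSup hT hy
    linarith
  refine le_antisymm ?_ (le_csInf hS hlb)
  have hTne : T.Nonempty := let ⟨x, hx⟩ := hS; let ⟨y, hy, _⟩ := hlow x hx; ⟨y, hy⟩
  have : sSup T ≤ 1 - sInf S := csSup_le hTne fun y hy => by
    obtain ⟨x, hx, hxy⟩ := hup y hy
    have := csInf_le ⟨_, hlb⟩ hx
    linarith
  linarith

theorem successValues_mem_unitInterval {ρ : Op (a × b)} (hρ : IsState ρ) {x : ℝ}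
    (hx : x ∈ successValues d ρ) : 0 ≤ x ∧ x ≤ 1 := by
  obtain ⟨K, L, M, N, hK, hL, hM, hN, hsum, _, rfl⟩ := hx
  have h : (ρ * (K + L + M + N)).trace.re = 1 := by rw [hsum, mul_one, hρ.2, Complex.one_re]
  simp only [mul_add, Matrix.trace_add, Complex.add_re] at h
  have h1 := re_trace_mul_nonneg hρ.1 hK
  have h2 := re_trace_mul_nonneg hρ.1 hL
  have h3 := re_trace_mul_nonneg hρ.1 hM
  have h4 := re_trace_mul_nonneg hρ.1 hN
  exact ⟨h1, by linarith⟩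

theorem isChannel_simulation {ρ : Op (a × b)} (hρ : IsState ρ)
    {L : Op ((Fin d × a) × (Fin d × b)) →ₗ[ℂ] Op (Fin d × Fin d)} (hL : IsLOCC L) :
    IsChannel (simulation ρ L) := hL.isChannel.comp (isChannel_appendState hρ)

end Main

end BQT

end

theorem mainTheorem2 (d : ℕ) (hd : 2 ≤ d) {a b : Type} [Fintype a] [DecidableEq a]
    [Fintype b] [DecidableEq b] (ρ : BQT.Op (a × b)) (hρ : BQT.IsState ρ) :
    BQT.errLOCC d ρ = BQT.errFidLOCC d ρ ∧
    BQT.errFidLOCC d ρ = 1 - sSup (BQT.successValues d ρ) ∧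
    (BQT.successValues d ρ).Nonempty ∧ BddAbove (BQT.successValues d ρ) := by
  open BQT in
  have : Nonempty (Fin d × Fin d) := ⟨(⟨0, by omega⟩, ⟨0, by omega⟩)⟩
  obtain ⟨L₀, hL₀⟩ := exists_isLOCC (d := d) (a := a) (b := b)
  have hbdd : BddAbove (successValues d ρ) :=
    ⟨1, fun x hx => (successValues_mem_unitInterval hρ hx).2⟩
  have h1 : errLOCC d ρ = 1 - sSup (successValues d ρ) := by
    refine csInf_eq_one_sub_csSup ⟨_, L₀, hL₀, rfl⟩ hbdd ?_ ?_
    · rintro x ⟨L, hL, rfl⟩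
      refine ⟨_, hL.entFid_mem_successValues hd ρ, ?_⟩
      have := le_half_diamondDist flipOp_unitary (isChannel_simulation hρ hL)
      -- The bound concerns the inverse swap after the simulation, whereas the success value uses
      -- the swap; the flip is its own adjoint.
      rwa [conjTranspose_flipOp] at this
    · intro y hy
      have hy1 := (successValues_mem_unitInterval hρ hy).2
      obtain ⟨K, L, M, N, hK, hL, hM, hN, -, hlocc, rfl⟩ := hy
      obtain ⟨R, hR, hsim⟩ := exists_simulation_eq hd hρ.1 hK hL hM hN
      exact ⟨_, ⟨_, hlocc, rfl⟩, half_diamondDist_le isChannel_swapChannel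
        (isChannel_simulation hρ hlocc) hy1 hR hsim⟩
  have h2 : errFidLOCC d ρ = 1 - sSup (successValues d ρ) := by
    refine csInf_eq_one_sub_csSup ⟨_, L₀, hL₀, rfl⟩ hbdd ?_ ?_
    · rintro x ⟨L, hL, rfl⟩
      refine ⟨_, hL.entFid_mem_successValues hd ρ, ?_⟩
      have := channelFidelity_le_entFid flipOp_unitary (isChannel_simulation hρ hL)
      rw [conjTranspose_flipOp] at this
      exact sub_le_sub_left this 1
    · intro y hy
      have hy0 := (successValues_mem_unitInterval hρ hy).1
      obtain ⟨K, L, M, N, hK, hL, hM, hN, -, hlocc, rfl⟩ := hy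
      obtain ⟨R, hR, hsim⟩ := exists_simulation_eq hd hρ.1 hK hL hM hN
      exact ⟨_, ⟨_, hlocc, rfl⟩, sub_le_sub_left (le_channelFidelity isChannel_swapChannel
        (isChannel_simulation hρ hlocc) hy0 hR hsim) 1⟩
  exact ⟨h1.trans h2.symm, h2, ⟨_, hL₀.entFid_mem_successValues hd ρ⟩, hbdd⟩
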